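/- **Theorem 1.2 (Local Pohozaev identity of scaling type).** Let $N+l\ge 3$, $p>1$, $\gamma\ge 0$, write $z=(x,y)\in\mathbb R^{N+l}$ with $x\in\mathbb R^N$, $y\in\mathbb R^l$, and put $\nabla_\gamma u=(\nabla_x u,|x|^\gamma\nabla_y u)$. Let $\Omega\subset\mathbb R^{N+l}$ be a bounded open set and $f:\mathbb R^{N+l}\times\mathbb R\to\mathbb R$ continuous, $F(z,t)=\int_0^t f(z,s)\,ds$. Let $W^{1,p}_\lambda(\Omega)$ be the space of $u\in L^p(\Omega)$ whose weak derivatives $\partial_{x_i}u$ and $|x|^\gamma\partial_{y_j}u$ (that is, the components of the weak Grushin gradient $\nabla_\gamma u$, defined by $\int_\Omega u\,\nabla_\gamma\varphi\,dz=-\int_\Omega\varphi\,\nabla_\gamma u\,dz$ for all $\varphi\in C_0^\infty(\Omega)$) lie in $L^p(\Omega)$, with norm $\big(\int_\Omega|\nabla_\gamma u|^p+|u|^p\,dz\big)^{1/p}$, and let $W^{1,p}_{\lambda,0}(\Omega)$ be the closure of $C_0^\infty(\Omega)$ in it. Let $u\in W^{1,p}_{\lambda,0}(\Omega)\cap C^1(\Omega)$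 be a weak solution of $-\Delta_\gamma^p u=f(z,u)$ in $\Omega$, $u=0$ on $\partial\Omega$; that is, for every $\varphi\in W^{1,p}_{\lambda,0}(\Omega)$ the function $f(z,u)\varphi$ is integrable on $\Omega$ and $$\int_\Omega|\nabla_\gamma u|^{p-2}\langle\nabla_\gamma u,\nabla_\gamma\varphi\rangle\,dz=\int_\Omega f(z,u)\varphi\,dz .$$ Assume that $z\mapsto F(z,u(z))$ is differentiable in $\Omega$, let $\nabla_zF(z,u)$ be defined by $$\nabla\big(F(z,u(z))\big)=\nabla_zF(z,u)+f(z,u)\nabla u ,$$ and assume that $\nabla_zF(z,u)$ is locally integrable in $\Omega$ (if $F$ is of class $C^1$, both assumptions hold and $\nabla_zF(z,u)$ is the partial gradient of $F$ in $z$). Then for every open set $D$ with $\overline D\subset\Omega$ and boundary of class $C^1$ (in particular, for every such subdomain), with outward unit normal $\nu=(\nu_x,\nu_y)$, $\nu_\gamma=(\nu_x,|x|^\gamma\nu_y)$ and surface measure $dS$, $$\begin{aligned} &\Big(-\frac{N+l}{p}+1\Big)\int_D f(z,u)u\,dz+\Big(-\frac{N+l}{p}+1\Big)\int_{\partial D}|\nabla_\gamma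 u|^{p-2}u\,\langle\nabla_\gamma u,\nu_\gamma\rangle\,dS\\ &\quad+\frac1p\int_{\partial D}|\nabla_\gamma u|^p\langle z,\nu\rangle\,dS-\int_{\partial D}|\nabla_\gamma u|^{p-2}\langle\nabla u,z\rangle\langle\nabla_\gamma u,\nu_\gamma\rangle\,dS-\int_D|\nabla_\gamma u|^{p-2}\gamma|x|^{2\gamma}|\nabla_yu|^2\,dz\\ &=\int_{\partial D}F(z,u)\langle z,\nu\rangle\,dS-(N+l)\int_DF(z,u)\,dz-\int_D\langle\nabla_zF(z,u),z\rangle\,dz . \end{aligned}$$ Here terms containing $|\nabla_\gamma u|^{p-2}$ are read as $0$ where $\nabla_\gamma u=0$. -/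

import Mathlib

open MeasureTheory Set

open scoped ContDiff

namespace Grushin

/-- The space `ℝ^{N+l}` of points `z = (x, y)`, with its Euclidean norm and Lebesgue measure; the
coordinates are `x i = z (Sum.inl i)` and `y j = z (Sum.inr j)`. -/
abbrev Space (N l : ℕ) : Type := EuclideanSpace ℝ (Fin N ⊕ Fin l)

/-- The `x`-component of a point or vector of `ℝ^{N+l}`. -/
def xPart {N l : ℕ} (v : Space N l) : EuclideanSpace ℝ (Fin N) :=
  WithLp.toLp 2 fun i => v (Sum.inl i)

/-- The `y`-component of a point or vector of `ℝ^{N+l}`. -/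
def yPart {N l : ℕ} (v : Space N l) : EuclideanSpace ℝ (Fin l) :=
  WithLp.toLp 2 fun j => v (Sum.inr j)

/-- The anisotropic scaling `v = (v_x, v_y) ↦ (v_x, |x|^γ v_y)` at the point `z = (x, y)`. It sends
`∇u` to the Grushin gradient `∇_γ u` and a normal `ν` to `ν_γ`. -/
noncomputable def scale {N l : ℕ} (γ : ℝ) (z v : Space N l) : Space N l :=
  WithLp.toLp 2
    (Sum.elim (fun i => v (Sum.inl i)) (fun j => ‖xPart z‖ ^ γ * v (Sum.inr j)))

/-- The classical Grushin gradient `∇_γ u = (∇_x u, |x|^γ ∇_y u)`. -/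
noncomputable def grad {N l : ℕ} (γ : ℝ) (u : Space N l → ℝ) (z : Space N l) : Space N l :=
  scale γ z (gradient u z)

/-- `φ ∈ C_0^∞(Ω)`. -/
structure IsTest {N l : ℕ} (Ω : Set (Space N l)) (φ : Space N l → ℝ) : Prop where
  contDiff : ContDiff ℝ ∞ φ
  hasCompactSupport : HasCompactSupport φ
  tsupport_subset : tsupport φ ⊆ Ω

/-- `G` is the weak Grushin gradient of `u` in `Ω`. The fields `∂/∂x_i` and `|x|^γ ∂/∂y_j` are
formally skew-adjoint, so this says `∫_Ω u ∇_γ φ = - ∫_Ω φ G` for all test functions `φ`. -/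
structure IsWeakGrad {N l : ℕ} (Ω : Set (Space N l)) (γ : ℝ) (u : Space N l → ℝ)
    (G : Space N l → Space N l) : Prop where
  locallyIntegrableOn : LocallyIntegrableOn u Ω
  locallyIntegrableOn_grad : LocallyIntegrableOn G Ω
  integral_eq : ∀ φ : Space N l → ℝ, IsTest Ω φ →
    ∫ z in Ω, u z • grad γ φ z = - ∫ z in Ω, φ z • G z

open Classical in
/-- The weak Grushin gradient of `u` in `Ω` (unique up to a null set of `Ω`; `0` if there is
none). -/
noncomputable def weakGrad {N l : ℕ} (Ω : Set (Space N l)) (γ : ℝ) (u : Space N l → ℝ) :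
    Space N l → Space N l :=
  if h : ∃ G, IsWeakGrad Ω γ u G then h.choose else 0

/-- The weighted Sobolev space `W^{1,p}_λ(Ω)`: `u ∈ L^p(Ω)` with weak Grushin gradient in
`L^p(Ω)`. -/
def Sobolev {N l : ℕ} (Ω : Set (Space N l)) (γ p : ℝ) : Set (Space N l → ℝ) :=
  {u | MemLp u (ENNReal.ofReal p) (volume.restrict Ω) ∧ (∃ G, IsWeakGrad Ω γ u G) ∧
    MemLp (weakGrad Ω γ u) (ENNReal.ofReal p) (volume.restrict Ω)}

/-- The norm `(∫_Ω |∇_γ u|^p + |u|^p dz)^{1/p}` of `W^{1,p}_λ(Ω)`. -/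
noncomputable def sobolevNorm {N l : ℕ} (Ω : Set (Space N l)) (γ p : ℝ) (u : Space N l → ℝ) : ℝ :=
  (∫ z in Ω, (‖weakGrad Ω γ u z‖ ^ p + |u z| ^ p)) ^ (1 / p)

/-- `W^{1,p}_{λ,0}(Ω)`: the closure of `C_0^∞(Ω)` in `W^{1,p}_λ(Ω)`. -/
def SobolevZero {N l : ℕ} (Ω : Set (Space N l)) (γ p : ℝ) : Set (Space N l → ℝ) :=
  {u | u ∈ Sobolev Ω γ p ∧
    ∀ ε : ℝ, 0 < ε → ∃ φ : Space N l → ℝ, IsTest Ω φ ∧ sobolevNorm Ω γ p (u - φ) < ε}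

/-- `u` is a weak solution of `-Δ_γ^p u = f(z, u)` in `Ω`, `u = 0` on `∂Ω`. The left integrand is
always integrable, by Hölder's inequality; integrability of the right one is part of the
definition. -/
structure IsWeakSolution {N l : ℕ} (Ω : Set (Space N l)) (γ p : ℝ) (f : Space N l → ℝ → ℝ)
    (u : Space N l → ℝ) : Prop where
  mem_sobolevZero : u ∈ SobolevZero Ω γ p
  integrable : ∀ φ ∈ SobolevZero Ω γ p, IntegrableOn (fun z => f z (u z) * φ z) Ω
  integral_eq : ∀ φ ∈ SobolevZero Ω γ p,
    ∫ z in Ω, ‖weakGrad Ω γ u z‖ ^ (p - 2) * inner ℝ (weakGrad Ω γ u z) (weakGrad Ω γ φ z) =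
      ∫ z in Ω, f z (u z) * φ z

/-- The primitive `F(z, t) = ∫_0^t f(z, s) ds`. -/
noncomputable def primitive {N l : ℕ} (f : Space N l → ℝ → ℝ) (z : Space N l) (t : ℝ) : ℝ :=
  ∫ s in (0 : ℝ)..t, f z s

/-- `P z` is `∇_z F(z, u(z))` on `Ω`, determined by
`∇ (F(z, u(z))) = ∇_z F(z, u(z)) + f(z, u(z)) ∇u(z)`; it is required to be locally integrable.
If `u` is `C^1` and `F` is `C^1` this is, by the chain rule, the partial gradient of `F` with
respect to `z` at `(z, u(z))`. -/
structure IsPartialGradient {N l : ℕ} (Ω : Set (Space N l)) (f : Space N l → ℝ → ℝ)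
    (u : Space N l → ℝ) (P : Space N l → Space N l) : Prop where
  locallyIntegrableOn : LocallyIntegrableOn P Ω
  hasGradientAt : ∀ z ∈ Ω,
    HasGradientAt (fun w => primitive f w (u w)) (P z + f z (u z) • gradient u z) z

/-- `ρ` is a `C^1` defining function of `D` in the neighbourhood `U` of `z`:
`D ∩ U = {ρ < 0} ∩ U` and `∇ρ(z) ≠ 0`. -/
structure IsDefiningFunction {N l : ℕ} (D : Set (Space N l)) (z : Space N l)
    (U : Set (Space N l)) (ρ : Space N l → ℝ) : Prop where
  isOpen : IsOpen U
  mem : z ∈ U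
  contDiffOn : ContDiffOn ℝ 1 ρ U
  gradient_ne_zero : gradient ρ z ≠ 0
  inter_eq : D ∩ U = {w ∈ U | ρ w < 0}

/-- `D` has a boundary of class `C^1` (and lies locally on one side of it). -/
def HasC1Boundary {N l : ℕ} (D : Set (Space N l)) : Prop :=
  ∀ z ∈ frontier D, ∃ U ρ, IsDefiningFunction D z U ρ

/-- `n` is the outward unit normal of `D` at its boundary point `z`. -/
def IsOutwardUnitNormal {N l : ℕ} (D : Set (Space N l)) (z n : Space N l) : Prop :=
  ∃ U ρ, IsDefiningFunction D z U ρ ∧ n = ‖gradient ρ z‖⁻¹ • gradient ρ z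

/-- The surface measure `dS` on `∂D`: the `(N+l-1)`-dimensional Hausdorff measure, in the
normalization that gives Lebesgue measure on hyperplanes, restricted to `∂D`. -/
noncomputable def surfaceMeasure {N l : ℕ} (D : Set (Space N l)) : Measure (Space N l) :=
  (Measure.euclideanHausdorffMeasure (N + l - 1)).restrict (frontier D)

end Grushin

/-!
The identity is a linear combination of three instances of the divergence theorem on `D`, for the
fields

* `V₁ = u A`, where `A = flux γ p u` is the field with `⟪A, v⟫ = |∇_γ u|^{p-2} ⟪∇_γ u, v_γ⟫`,
* `V₂ = ⟪∇u, z⟫ A - |∇_γ u|^p z / p` (`Grushin.pohozaevField`),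
* `V₃ = F(z, u) z`,

whose distributional divergences are

* `w₁ = |∇_γ u|^p - f(z, u) u`,
* `w₂ = -f(z, u) ⟪∇u, z⟫ + (1 - (N + l) / p) |∇_γ u|^p - γ |∇_γ u|^{p-2} |x|^{2γ} |∇_y u|²`,
* `w₃ = (N + l) F(z, u) + ⟪∇_z F(z, u) + f(z, u) ∇u, z⟫`.

Since `u` is only `C^1` and `D` is only a `C^1` domain, both the divergences and the divergence
theorem need an argument.

The divergence of `V₂` is computed without second derivatives of `u`, from the convexity of
`ξ ↦ |ξ|^p / p`. For a test function `η ≥ 0` and small `t`, test the equation with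
`φ = η (u(e^t ·) - u)`. The gradient inequality bounds `|∇_γ u|^{p-2} ⟪∇_γ u, ∇_γ (u(e^t ·) - u)⟫`
by the increment of the energy density, so a function `E(t)` built from `η`, `u` and the energy
density is nonnegative and vanishes at `t = 0`
(`Grushin.IsWeakSolution.setIntegral_dilation_nonneg`). After the change of variables `w = e^t z`
the dilation falls on `η` and on the constant matrix by which it acts on `∇_γ u`, so `E` is
differentiable in `t`. Its derivative at the minimum `t = 0` is zero, and this is the weak form of
`div V₂ = w₂` (`Grushin.IsWeakSolution.weak_divergence_pohozaevField`).

The divergence theorem (`HasUnitNormal.setIntegral_eq_of_weak_divergence`) holds for continuous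
fields with locally integrable distributional divergence. It is obtained by testing the weak
identity with the mollified indicator of `D`, whose gradient is the mollification of `-ν dS`. That
last fact is the Gauss–Green formula for constant directions
(`HasUnitNormal.setIntegral_fderiv_eq`), which is proved directly for the Hausdorff measure, with no
parametrization of `∂D`. Near a boundary point `D` is nearly a half-space with normal `n`
(`FlatIn`). Fubini's theorem along the lines in direction `n` expresses `∫_D ∂_n θ` through the
projection of `∂D` to the tangent plane, a map that distorts surface measure by a factor close to
`1`. In a direction `v` with `⟪v, n⟫ > 0` that is not nearly tangential, `D` is locally invariant
under translation by `-v`, so that `∫_D ∂_v θ ≥ 0`. Together these give the formula up to a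
relative error `ε`; a partition of unity and `ε → 0` finish.
-/

open Metric Filter Topology Module
open scoped RealInnerProductSpace NNReal ENNReal Convolution

/-! ### Integration along parallel lines and nearly flat domains -/

section FlatDomain

variable {E : Type*} [NormedAddCommGroup E] [InnerProductSpace ℝ E] [FiniteDimensional ℝ E]
  [MeasurableSpace E] [BorelSpace E]

/-- Lebesgue measure splits along the unit vector `n` and its orthogonal complement. -/
theorem measurePreserving_smul_add_coe_orthogonal {n : E} (hn : ‖n‖ = 1) :
    MeasurePreserving (fun q : (ℝ ∙ n)ᗮ × ℝ => (q.1 : E) + q.2 • n) := by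
  have h1 := (LinearIsometryEquiv.toSpanUnitSingleton (𝕜 := ℝ) n hn).measurePreserving.prod
    (MeasurePreserving.id (volume : Measure (ℝ ∙ n)ᗮ))
  have h2 := (ℝ ∙ n).orthogonalDecomposition.symm.measurePreserving.comp
    ((WithLp.volume_preserving_toLp (ℝ ∙ n) (ℝ ∙ n)ᗮ).comp h1)
  have h3 := h2.comp (Measure.measurePreserving_swap (μ := (volume : Measure (ℝ ∙ n)ᗮ))
    (ν := (volume : Measure ℝ)))
  convert h3 using 1
  · ext q
    simp [add_comm]
  · rfl

omit [FiniteDimensional ℝ E] [MeasurableSpace E] [BorelSpace E] in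
theorem injective_smul_add_coe_orthogonal {n : E} (hn : ‖n‖ = 1) :
    Function.Injective (fun q : (ℝ ∙ n)ᗮ × ℝ => (q.1 : E) + q.2 • n) := by
  rintro ⟨w, t⟩ ⟨w', t'⟩ h
  have hw := Submodule.mem_orthogonal_singleton_iff_inner_right.1 w.2
  have hw' := Submodule.mem_orthogonal_singleton_iff_inner_right.1 w'.2
  have ht : t = t' := by
    have := congrArg (fun v : E => ⟪n, v⟫) h
    simpa [inner_add_right, inner_smul_right, hw, hw', hn] using this
  subst ht
  simpa using h

theorem measurableEmbedding_smul_add_coe_orthogonal {n : E} (hn : ‖n‖ = 1) :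
    MeasurableEmbedding (fun q : (ℝ ∙ n)ᗮ × ℝ => (q.1 : E) + q.2 • n) :=
  Continuous.measurableEmbedding (by fun_prop) (injective_smul_add_coe_orthogonal hn)

theorem integrable_integral_line {n : E} (hn : ‖n‖ = 1) {F : E → ℝ} (hF : Integrable F) :
    Integrable (fun w : (ℝ ∙ n)ᗮ => ∫ t : ℝ, F (w + t • n)) := by
  have h := ((measurePreserving_smul_add_coe_orthogonal hn).integrable_comp_emb
    (measurableEmbedding_smul_add_coe_orthogonal hn)).2 hF
  exact h.integral_prod_left

/-- Fubini's theorem along the lines in direction `n`. -/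
theorem integral_integral_line {n : E} (hn : ‖n‖ = 1) {F : E → ℝ} (hF : Integrable F) :
    ∫ w : (ℝ ∙ n)ᗮ, ∫ t : ℝ, F (w + t • n) = ∫ z, F z := by
  have h := ((measurePreserving_smul_add_coe_orthogonal hn).integrable_comp_emb
    (measurableEmbedding_smul_add_coe_orthogonal hn)).2 hF
  rw [← (measurePreserving_smul_add_coe_orthogonal hn).integral_comp
    (measurableEmbedding_smul_add_coe_orthogonal hn)]
  exact (integral_prod _ h).symm

omit [FiniteDimensional ℝ E] [MeasurableSpace E] [BorelSpace E] in
theorem orthogonalProjectionOnto_add_smul_eq {n : E} (hn : ‖n‖ = 1) (z : E) :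
    (((ℝ ∙ n)ᗮ.orthogonalProjectionOnto z : (ℝ ∙ n)ᗮ) : E) + ⟪n, z⟫ • n = z := by
  have := Submodule.starProjection_add_starProjection_orthogonal (K := ℝ ∙ n) z
  rw [Submodule.starProjection_unit_singleton ℝ hn] at this
  rw [add_comm]; exact this

/-- `D` is nearly a half-space with outward normal `n` inside `B`: if `z'` is a point of `closure D`
in `B`, then `D` contains every `z ∈ B` such that `z' - z` makes with `n` an angle of cosine greater
than `ε`. No graph or coordinate system is involved, and the smaller `ε` is, the flatter `∂D` is. -/
def FlatIn (D B : Set E) (n : E) (ε : ℝ) : Prop :=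
  ∀ z ∈ B, ∀ z' ∈ B, z' ∈ closure D → ε * ‖z' - z‖ < ⟪z' - z, n⟫ → z ∈ D

variable {D : Set E} {c n : E} {r ε : ℝ}

omit [FiniteDimensional ℝ E] [MeasurableSpace E] [BorelSpace E] in
/-- Any two boundary points in the flat region differ by a nearly tangential vector. -/
theorem FlatIn.abs_inner_le {B : Set E} (h : FlatIn D B n ε) (hD : IsOpen D) {z z' : E} (hz : z ∈ B)
    (hz' : z' ∈ B) (hzD : z ∈ frontier D) (hzD' : z' ∈ frontier D) :
    |⟪z' - z, n⟫| ≤ ε * ‖z' - z‖ := by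
  rw [hD.frontier_eq] at hzD hzD'
  refine abs_le'.2 ⟨?_, ?_⟩ <;> by_contra! H
  · exact hzD.2 (h z hz z' hz' hzD'.1 H)
  · refine hzD'.2 (h z' hz' z hz hzD.1 ?_)
    rwa [← inner_neg_left, neg_sub, norm_sub_rev] at H

omit [FiniteDimensional ℝ E] [MeasurableSpace E] [BorelSpace E] in
/-- On the boundary in the flat region, the projection along `n` has a Lipschitz inverse. -/
theorem FlatIn.norm_sub_le_norm_orthogonalProjection_sub {B : Set E} (h : FlatIn D B n ε)
    (hD : IsOpen D) (hn : ‖n‖ = 1) {z z' : E} (hz : z ∈ B) (hz' : z' ∈ B)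
    (hzD : z ∈ frontier D) (hzD' : z' ∈ frontier D) :
    (1 - ε) * ‖z' - z‖ ≤ ‖(ℝ ∙ n)ᗮ.orthogonalProjectionOnto z' -
      (ℝ ∙ n)ᗮ.orthogonalProjectionOnto z‖ := by
  have h1 := h.abs_inner_le hD hz hz' hzD hzD'
  have h2 := orthogonalProjectionOnto_add_smul_eq hn (z' - z)
  have h3 : ‖z' - z‖ ≤ ‖(ℝ ∙ n)ᗮ.orthogonalProjectionOnto (z' - z)‖ + |⟪z' - z, n⟫| := by
    conv_lhs => rw [← h2]
    refine (norm_add_le _ _).trans ?_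
    rw [norm_smul, hn, mul_one, real_inner_comm]
    simp
  rw [map_sub] at h3
  linarith

end FlatDomain

/-! ### Directional derivatives integrated over a domain, line by line -/

section Slices

variable {E : Type*} [NormedAddCommGroup E] [InnerProductSpace ℝ E]
  {D : Set E} {c n : E} {r ε : ℝ} {θ : E → ℝ}

theorem hasCompactSupport_comp_line {v : E} (hv : ‖v‖ = 1) (hc : HasCompactSupport θ) (w : E) :
    HasCompactSupport fun t : ℝ => θ (w + t • v) := by
  refine hc.comp_isClosedEmbedding (g := fun t : ℝ => w + t • v) ?_
  refine Isometry.isClosedEmbedding (Isometry.of_dist_eq fun s t => ?_)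
  rw [dist_add_left, dist_eq_norm, ← sub_smul, norm_smul, hv, mul_one, dist_eq_norm]

theorem hasDerivAt_comp_line (hθ : ContDiff ℝ 1 θ) (w v : E) (t : ℝ) :
    HasDerivAt (fun t : ℝ => θ (w + t • v)) (fderiv ℝ θ (w + t • v) v) t := by
  have h1 : HasDerivAt (fun t : ℝ => w + t • v) v t := by
    simpa using ((hasDerivAt_id t).smul_const v).const_add w
  exact ((hθ.differentiable one_ne_zero).differentiableAt.hasFDerivAt).comp_hasDerivAt t h1

theorem fderiv_eq_zero_of_notMem (hs : tsupport θ ⊆ closedBall c r) {z : E}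
    (hz : z ∉ closedBall c r) : fderiv ℝ θ z = 0 :=
  image_eq_zero_of_notMem_tsupport fun h => hz (hs (tsupport_fderiv_subset ℝ h))

/-- On a line that crosses `∂D` exactly once, from inside to outside, the fundamental theorem of
calculus integrates `∂_v θ` over the part of the line in `D` to the value of `θ` at the crossing. -/
theorem integral_line_indicator_of_mem_frontier (hD : IsOpen D) {v : E} (hv : ‖v‖ = 1)
    (hθ : ContDiff ℝ 1 θ) (hc : HasCompactSupport θ) (hs : tsupport θ ⊆ closedBall c r)
    (hmono : ∀ z ∈ closedBall c r, ∀ t : ℝ, 0 < t → z + t • v ∈ closedBall c r →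
      z + t • v ∈ closure D → z ∈ D)
    {w : E} {t₀ : ℝ} (hB : w + t₀ • v ∈ closedBall c r) (hF : w + t₀ • v ∈ frontier D) :
    ∫ t : ℝ, D.indicator (fun z => fderiv ℝ θ z v) (w + t • v) = θ (w + t₀ • v) := by
  classical
  rw [hD.frontier_eq] at hF
  -- Within the support of `θ`, the line is in `D` before the time `t₀` and outside `D` after it.
  have key : (fun t : ℝ => D.indicator (fun z => fderiv ℝ θ z v) (w + t • v)) =ᵐ[volume]
      (Iic t₀).indicator (deriv fun t : ℝ => θ (w + t • v)) := by
    have hne : ∀ᵐ t : ℝ, t ≠ t₀ := by simp [ae_iff, measure_singleton]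
    filter_upwards [hne] with t ht
    rw [indicator_apply, indicator_apply, (hasDerivAt_comp_line hθ w v t).deriv]
    by_cases hzB : w + t • v ∈ closedBall c r
    swap
    · simp [fderiv_eq_zero_of_notMem hs hzB]
    have hstep : ∀ a b : ℝ, w + a • v + (b - a) • v = w + b • v := fun a b => by
      rw [add_assoc, ← add_smul]; congr 2; ring
    congr 1
    refine propext ⟨fun h => ?_, fun h => ?_⟩
    · by_contra hlt
      rw [mem_Iic, not_le] at hlt
      refine hF.2 (hmono _ hB (t - t₀) (by linarith) ?_ ?_) <;> rw [hstep]
      exacts [hzB, subset_closure h]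
    · refine hmono _ hzB (t₀ - t) (sub_pos.2 (lt_of_le_of_ne h ht)) ?_ ?_ <;> rw [hstep]
      exacts [hB, hF.1]
  rw [integral_congr_ae key, integral_indicator measurableSet_Iic]
  exact HasCompactSupport.integral_Iic_deriv_eq (hθ.comp (by fun_prop))
    (hasCompactSupport_comp_line hv hc w) t₀

/-- A line that misses `∂D` within the support of `θ` contributes nothing: there it stays inside `D`
or outside `closure D`, because it meets a ball in a connected set. -/
theorem integral_line_indicator_of_notMem_frontier (hD : IsOpen D) {v : E} (hv : ‖v‖ = 1)
    (hθ : ContDiff ℝ 1 θ) (hc : HasCompactSupport θ) (hs : tsupport θ ⊆ closedBall c r)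
    {w : E} (hF : ∀ t : ℝ, w + t • v ∈ closedBall c r → w + t • v ∉ frontier D) :
    ∫ t : ℝ, D.indicator (fun z => fderiv ℝ θ z v) (w + t • v) = 0 := by
  classical
  set S : Set ℝ := (fun t : ℝ => w + t • v) ⁻¹' closedBall c r with hS
  have hSc : Convex ℝ S := by
    have hSl : S = (AffineMap.lineMap w (w + v) : ℝ →ᵃ[ℝ] E) ⁻¹' closedBall c r := by
      ext t
      simp [hS, AffineMap.lineMap_apply, add_comm]
    rw [hSl]
    exact (convex_closedBall c r).affine_preimage _
  have hcont : Continuous fun t : ℝ => w + t • v := by fun_prop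
  have hzero : ∀ t ∉ S, fderiv ℝ θ (w + t • v) = 0 := fun t ht => fderiv_eq_zero_of_notMem hs ht
  rcases hSc.isPreconnected.subset_or_subset (hD.preimage hcont)
    (isClosed_closure.isOpen_compl.preimage hcont)
    (Disjoint.preimage _ (disjoint_compl_right.mono_right (compl_subset_compl.2 subset_closure)))
    (fun t ht => by
      by_contra hcon
      simp only [mem_union, mem_preimage, mem_compl_iff, not_or, not_not] at hcon
      exact hF t ht (hD.frontier_eq ▸ ⟨hcon.2, hcon.1⟩)) with h | h
  · have : (fun t : ℝ => D.indicator (fun z => fderiv ℝ θ z v) (w + t • v)) =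
        deriv fun t : ℝ => θ (w + t • v) := by
      ext t
      rw [(hasDerivAt_comp_line hθ w v t).deriv, indicator_apply]
      by_cases ht : t ∈ S
      · exact if_pos (h ht)
      · simp [hzero t ht]
    rw [this]
    have h1 := (hθ.comp (show ContDiff ℝ 1 fun t : ℝ => w + t • v by fun_prop))
    have h2 := hasCompactSupport_comp_line hv hc w
    exact integral_eq_zero_of_hasDerivAt_of_integrable
      (fun t => (h1.differentiable one_ne_zero).differentiableAt.hasDerivAt)
      ((h1.continuous_deriv le_rfl).integrable_of_hasCompactSupport h2.deriv)
      (h1.continuous.integrable_of_hasCompactSupport h2)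
  · have : (fun t : ℝ => D.indicator (fun z => fderiv ℝ θ z v) (w + t • v)) = fun _ => 0 := by
      ext t
      rw [indicator_apply]
      by_cases ht : t ∈ S
      · exact if_neg fun hD' => h ht (subset_closure hD')
      · simp [hzero t ht]
    simp [this]

variable [FiniteDimensional ℝ E] [MeasurableSpace E] [BorelSpace E]

theorem integrable_fderiv_apply (hθ : ContDiff ℝ 1 θ) (hc : HasCompactSupport θ) (v : E) :
    Integrable fun z => fderiv ℝ θ z v := by
  refine Continuous.integrable_of_hasCompactSupport (by
    have := hθ.continuous_fderiv one_ne_zero; fun_prop) ?_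
  exact (hc.fderiv ℝ).comp_left (g := fun L : E →L[ℝ] ℝ => L v) (by simp)

/-- If `D` is locally invariant under translation by `-v`, then `-∂_v 1_D` is a positive
distribution. -/
theorem setIntegral_fderiv_nonneg (hD : IsOpen D) {v : E}
    (hθ : ContDiff ℝ 1 θ) (hc : HasCompactSupport θ) (hs : tsupport θ ⊆ closedBall c r)
    (hpos : ∀ z, 0 ≤ θ z)
    (hmono : ∀ z ∈ closedBall c r, ∀ t : ℝ, 0 < t → z + t • v ∈ closedBall c r →
      z + t • v ∈ closure D → z ∈ D) :
    0 ≤ ∫ z in D, fderiv ℝ θ z v := by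
  rcases eq_or_ne v 0 with rfl | hv0
  · simp
  have hvp : 0 < ‖v‖ := norm_pos_iff.2 hv0
  set e : E := ‖v‖⁻¹ • v with he
  have hen : ‖e‖ = 1 := by
    rw [he, norm_smul, norm_inv, norm_norm, inv_mul_cancel₀ hvp.ne']
  have hve : v = ‖v‖ • e := by rw [he, smul_smul, mul_inv_cancel₀ hvp.ne', one_smul]
  have hmono' : ∀ z ∈ closedBall c r, ∀ t : ℝ, 0 < t → z + t • e ∈ closedBall c r →
      z + t • e ∈ closure D → z ∈ D := fun z hz t ht h1 h2 => by
    rw [he, smul_smul] at h1 h2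
    exact hmono z hz _ (by positivity) h1 h2
  have hind : Integrable (D.indicator fun z => fderiv ℝ θ z e) :=
    (integrable_fderiv_apply hθ hc e).indicator hD.measurableSet
  have key : 0 ≤ ∫ z in D, fderiv ℝ θ z e := by
    rw [← integral_indicator hD.measurableSet, ← integral_integral_line hen hind]
    refine integral_nonneg fun w => ?_
    by_cases hex : ∃ t₀ : ℝ, (w : E) + t₀ • e ∈ closedBall c r ∧ (w : E) + t₀ • e ∈ frontier D
    · obtain ⟨t₀, h1, h2⟩ := hex
      simp only [Pi.zero_apply]
      rw [integral_line_indicator_of_mem_frontier hD hen hθ hc hs hmono' h1 h2]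
      exact hpos _
    · push Not at hex
      simp only [Pi.zero_apply]
      rw [integral_line_indicator_of_notMem_frontier hD hen hθ hc hs hex]
  have : ∀ z, fderiv ℝ θ z v = ‖v‖ * fderiv ℝ θ z e := fun z => by
    conv_lhs => rw [hve]
    simp
  simp_rw [this]
  rw [integral_const_mul]
  positivity

end Slices

/-! ### Projection of the boundary to a tangent plane -/

theorem LipschitzOnWith.euclideanHausdorffMeasure_image_le {X Y : Type*} [EMetricSpace X]
    [MeasurableSpace X] [BorelSpace X] [EMetricSpace Y] [MeasurableSpace Y] [BorelSpace Y]
    {K : ℝ≥0} {f : X → Y} {s : Set X} (h : LipschitzOnWith K f s) (d : ℕ) :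
    μHE[d] (f '' s) ≤ (K : ℝ≥0∞) ^ d * μHE[d] s := by
  simp only [Measure.euclideanHausdorffMeasure_def, Measure.smul_apply, ENNReal.smul_def,
    smul_eq_mul]
  rw [mul_left_comm]
  gcongr
  simpa using h.hausdorffMeasure_image_le (d := d) (by positivity)

section Projection

variable {E : Type*} [NormedAddCommGroup E] [InnerProductSpace ℝ E] [FiniteDimensional ℝ E]
  [MeasurableSpace E] [BorelSpace E]
  {D : Set E} {c n : E} {r ε : ℝ} {θ : E → ℝ} {m : ℕ}

/-- On a hyperplane the normalized Hausdorff measure is Lebesgue measure. -/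
theorem euclideanHausdorffMeasure_orthogonal_singleton (hm : finrank ℝ E = m + 1) (hn : ‖n‖ = 1) :
    (μHE[m] : Measure (ℝ ∙ n)ᗮ) = volume := by
  have : Fact (finrank ℝ E = m + 1) := ⟨hm⟩
  have h := Submodule.finrank_orthogonal_span_singleton (𝕜 := ℝ) (n := m) (v := n)
    (by rintro rfl; simp at hn)
  rw [← InnerProductSpace.euclideanHausdorffMeasure_eq_volume, h]

/-- Orthogonal projection is `1`-Lipschitz, so it does not increase surface measure. -/
theorem volume_restrict_image_le_map (hm : finrank ℝ E = m + 1) (hn : ‖n‖ = 1) :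
    (volume : Measure (ℝ ∙ n)ᗮ).restrict
        ((ℝ ∙ n)ᗮ.orthogonalProjectionOnto '' (frontier D ∩ closedBall c r)) ≤
      (μHE[m].restrict (frontier D ∩ closedBall c r)).map (ℝ ∙ n)ᗮ.orthogonalProjectionOnto := by
  set P := (ℝ ∙ n)ᗮ.orthogonalProjectionOnto
  refine Measure.le_iff.2 fun A hA => ?_
  rw [Measure.restrict_apply hA, Measure.map_apply P.continuous.measurable hA,
    Measure.restrict_apply (P.continuous.measurable hA),
    ← euclideanHausdorffMeasure_orthogonal_singleton hm hn, inter_comm A, ← image_inter_preimage,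
    inter_comm (P ⁻¹' A)]
  simpa using ((ℝ ∙ n)ᗮ.lipschitzWith_orthogonalProjectionOnto.lipschitzOnWith
    (s := (frontier D ∩ closedBall c r) ∩ P ⁻¹' A)).euclideanHausdorffMeasure_image_le m

/-- In a flat region the projection of `∂D` along `n` has an inverse with Lipschitz constant
`(1 - ε)⁻¹`, which bounds how much it can shrink surface measure. -/
theorem FlatIn.map_le_smul_volume_restrict_image (h : FlatIn D (closedBall c r) n ε)
    (hD : IsOpen D) (hε : ε < 1) (hm : finrank ℝ E = m + 1) (hn : ‖n‖ = 1) :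
    (μHE[m].restrict (frontier D ∩ closedBall c r)).map (ℝ ∙ n)ᗮ.orthogonalProjectionOnto ≤
      ENNReal.ofReal ((1 - ε)⁻¹ ^ m) • (volume : Measure (ℝ ∙ n)ᗮ).restrict
        ((ℝ ∙ n)ᗮ.orthogonalProjectionOnto '' (frontier D ∩ closedBall c r)) := by
  set P := (ℝ ∙ n)ᗮ.orthogonalProjectionOnto
  set Γ := frontier D ∩ closedBall c r
  have hε' : 0 < 1 - ε := by linarith
  have hK : 0 ≤ (1 - ε)⁻¹ := by positivity
  have hinj : ∀ z ∈ Γ, ∀ z' ∈ Γ, ‖z' - z‖ ≤ (1 - ε)⁻¹ * ‖P z' - P z‖ := fun z hz z' hz' => by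
    rw [inv_mul_eq_div, le_div_iff₀ hε', mul_comm]
    exact h.norm_sub_le_norm_orthogonalProjection_sub hD hn hz.2 hz'.2 hz.1 hz'.1
  have hinv : LeftInvOn (Function.invFunOn P Γ) P Γ := by
    refine InjOn.leftInvOn_invFunOn fun z hz z' hz' hP => ?_
    have := hinj z hz z' hz'
    rw [hP, sub_self, norm_zero, mul_zero, norm_le_zero_iff, sub_eq_zero] at this
    exact this.symm
  refine Measure.le_iff.2 fun A hA => ?_
  rw [Measure.smul_apply, Measure.restrict_apply hA, Measure.map_apply P.continuous.measurable hA,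
    Measure.restrict_apply (P.continuous.measurable hA),
    ← euclideanHausdorffMeasure_orthogonal_singleton hm hn, inter_comm A, ← image_inter_preimage,
    inter_comm (P ⁻¹' A), smul_eq_mul]
  have hlip : LipschitzOnWith (Real.toNNReal (1 - ε)⁻¹) (Function.invFunOn P Γ)
      (P '' (Γ ∩ P ⁻¹' A)) := by
    refine LipschitzOnWith.of_dist_le_mul ?_
    rintro _ ⟨z, hz, rfl⟩ _ ⟨z', hz', rfl⟩
    rw [hinv hz.1, hinv hz'.1, dist_eq_norm, dist_eq_norm, Real.coe_toNNReal _ hK]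
    exact hinj z' hz'.1 z hz.1
  have himg : Function.invFunOn P Γ '' (P '' (Γ ∩ P ⁻¹' A)) = Γ ∩ P ⁻¹' A :=
    (hinv.mono inter_subset_left).image_image
  have := hlip.euclideanHausdorffMeasure_image_le m
  rw [himg] at this
  rw [ENNReal.ofReal_pow hK]
  exact this

omit [MeasurableSpace E] [BorelSpace E] in
theorem isCompact_frontier_inter_closedBall :
    IsCompact (frontier D ∩ closedBall c r) :=
  (isCompact_closedBall c r).inter_left isClosed_frontier

theorem FlatIn.euclideanHausdorffMeasure_lt_top (h : FlatIn D (closedBall c r) n ε)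
    (hD : IsOpen D) (hε : ε < 1) (hm : finrank ℝ E = m + 1) (hn : ‖n‖ = 1) :
    μHE[m] (frontier D ∩ closedBall c r) < ⊤ := by
  have h1 := h.map_le_smul_volume_restrict_image hD hε hm hn univ
  rw [Measure.map_apply (ContinuousLinearMap.continuous _).measurable .univ, Measure.smul_apply,
    preimage_univ, Measure.restrict_apply_univ, Measure.restrict_apply_univ] at h1
  refine h1.trans_lt (ENNReal.mul_lt_top ENNReal.ofReal_lt_top ?_)
  exact (isCompact_frontier_inter_closedBall.image
    (ContinuousLinearMap.continuous _)).measure_lt_top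

/-- In a flat region, integrating `∂_n θ` over `D` agrees with integrating `θ` over `∂D` up to
the factor by which the projection along `n` can shrink surface measure. -/
theorem FlatIn.setIntegral_fderiv_le_and_le (h : FlatIn D (closedBall c r) n ε)
    (hD : IsOpen D) (hε : ε < 1) (hm : finrank ℝ E = m + 1) (hn : ‖n‖ = 1)
    (hθ : ContDiff ℝ 1 θ) (hc : HasCompactSupport θ) (hs : tsupport θ ⊆ closedBall c r)
    (hpos : ∀ z, 0 ≤ θ z) :
    ∫ z in D, fderiv ℝ θ z n ≤ ∫ z, θ z ∂(μHE[m].restrict (frontier D)) ∧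
    ∫ z, θ z ∂(μHE[m].restrict (frontier D)) ≤ (1 - ε)⁻¹ ^ m * ∫ z in D, fderiv ℝ θ z n := by
  set P := (ℝ ∙ n)ᗮ.orthogonalProjectionOnto with hP
  set Γ := frontier D ∩ closedBall c r with hΓ
  set G : (ℝ ∙ n)ᗮ → ℝ := fun w => ∫ t : ℝ, D.indicator (fun z => fderiv ℝ θ z n) (w + t • n)
    with hG
  have hε' : 0 < 1 - ε := by linarith
  have hmono : ∀ z ∈ closedBall c r, ∀ t : ℝ, 0 < t → z + t • n ∈ closedBall c r →
      z + t • n ∈ closure D → z ∈ D := fun z hz t ht hz' hcl => by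
    refine h z hz _ hz' hcl ?_
    rw [add_sub_cancel_left, norm_smul, inner_smul_left, real_inner_self_eq_norm_sq, hn]
    simp only [Real.norm_eq_abs, abs_of_pos ht, conj_trivial]
    nlinarith
  have hGP : ∀ z ∈ Γ, G (P z) = θ z := fun z hz => by
    have hz' := orthogonalProjectionOnto_add_smul_eq hn z
    have := integral_line_indicator_of_mem_frontier (w := P z) (t₀ := ⟪n, z⟫) hD hn hθ hc hs hmono
      (by rw [hz']; exact hz.2) (by rw [hz']; exact hz.1)
    rw [hz'] at this
    exact this
  have hG0 : ∀ w ∉ P '' Γ, G w = 0 := fun w hw => by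
    refine integral_line_indicator_of_notMem_frontier hD hn hθ hc hs fun t ht hF => hw
      ⟨_, ⟨hF, ht⟩, ?_⟩
    rw [map_add, map_smul, hP, Submodule.orthogonalProjectionOnto_mem_subspace_eq_self]
    simp
  have hind : Integrable (D.indicator fun z => fderiv ℝ θ z n) :=
    (integrable_fderiv_apply hθ hc n).indicator hD.measurableSet
  have hGi : Integrable G := integrable_integral_line hn hind
  have hGpos : ∀ w, 0 ≤ G w := fun w => by
    by_cases hw : w ∈ P '' Γ
    · obtain ⟨z, hz, rfl⟩ := hw
      rw [hGP z hz]; exact hpos z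
    · rw [hG0 w hw]
  have hT : ∫ z in D, fderiv ℝ θ z n = ∫ w, G w ∂volume.restrict (P '' Γ) := by
    rw [setIntegral_eq_integral_of_forall_compl_eq_zero hG0, hG, integral_integral_line hn hind,
      integral_indicator hD.measurableSet]
  have hle := h.map_le_smul_volume_restrict_image hD hε hm hn
  have hge := volume_restrict_image_le_map (D := D) (c := c) (r := r) hm hn
  have hGsm : Integrable G (ENNReal.ofReal ((1 - ε)⁻¹ ^ m) • volume.restrict (P '' Γ)) :=
    hGi.restrict.smul_measure ENNReal.ofReal_ne_top
  have hGmap : Integrable G ((μHE[m].restrict Γ).map P) := hGsm.mono_measure hle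
  have hS : ∫ z, θ z ∂(μHE[m].restrict (frontier D)) = ∫ w, G w ∂(μHE[m].restrict Γ).map P := by
    rw [integral_map P.continuous.measurable.aemeasurable hGmap.1,
      setIntegral_congr_fun (isCompact_frontier_inter_closedBall.measurableSet)
        (fun z hz => hGP z hz)]
    refine setIntegral_eq_of_subset_of_forall_sdiff_eq_zero isClosed_frontier.measurableSet
      inter_subset_left ?_
    intro z hz
    exact image_eq_zero_of_notMem_tsupport fun hz' => hz.2 ⟨hz.1, hs hz'⟩
  rw [hT, hS]
  refine ⟨integral_mono_measure hge (ae_of_all _ hGpos) hGmap, ?_⟩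
  refine (integral_mono_measure hle (ae_of_all _ hGpos) hGsm).trans_eq ?_
  rw [integral_smul_measure, ENNReal.toReal_ofReal (by positivity), smul_eq_mul]

/-- Approximate Gauss–Green formula in a flat region. The normal component of `e` is handled by
`FlatIn.setIntegral_fderiv_le_and_le`. The tangential component `e - ⟪e, n⟫ n` contributes little:
tilting it slightly towards `±n` gives directions in which the integral has a sign. -/
theorem FlatIn.abs_setIntegral_fderiv_sub_le (h : FlatIn D (closedBall c r) n ε)
    (hD : IsOpen D) (hε0 : 0 < ε) (hε : ε < 1 / 2) (hm : finrank ℝ E = m + 1) (hn : ‖n‖ = 1)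
    (hθ : ContDiff ℝ 1 θ) (hc : HasCompactSupport θ) (hs : tsupport θ ⊆ closedBall c r)
    (hpos : ∀ z, 0 ≤ θ z) {e : E} (he : ‖e‖ = 1) {ν : E → E}
    (hν : AEStronglyMeasurable ν (μHE[m].restrict (frontier D)))
    (hνn : ∀ z ∈ frontier D ∩ closedBall c r, ‖ν z - n‖ ≤ ε) :
    |(∫ z in D, fderiv ℝ θ z e) - ∫ z, θ z * ⟪e, ν z⟫ ∂(μHE[m].restrict (frontier D))| ≤
      (5 + m) * ε * ∫ z, θ z ∂(μHE[m].restrict (frontier D)) := by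
  set a := ⟪e, n⟫ with ha
  have ha1 : |a| ≤ 1 := by simpa [he, hn] using abs_real_inner_le_norm e n
  obtain ⟨ha1l, ha1u⟩ := abs_le.1 ha1
  obtain ⟨hTS, hST⟩ := h.setIntegral_fderiv_le_and_le hD (by linarith) hm hn hθ hc hs hpos
  set T := ∫ z in D, fderiv ℝ θ z n with hT
  set S := ∫ z, θ z ∂(μHE[m].restrict (frontier D)) with hS
  have hS0 : 0 ≤ S := integral_nonneg hpos
  have hε' : 0 < 1 - ε := by linarith
  -- Any direction making a definite angle with the tangent plane gives a positive distribution.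
  have hcone : ∀ v : E, ‖v‖ < 4 → 4 * ε ≤ ⟪v, n⟫ → 0 ≤ ∫ z in D, fderiv ℝ θ z v :=
    fun v hv hvn => by
      refine setIntegral_fderiv_nonneg hD hθ hc hs hpos fun z hz t ht hz' hcl =>
        h z hz _ hz' hcl ?_
      rw [add_sub_cancel_left, norm_smul, inner_smul_left]
      simp only [Real.norm_eq_abs, abs_of_pos ht, conj_trivial]
      nlinarith [mul_pos ht hε0]
  have hlin : ∀ (x : ℝ), ∫ z in D, fderiv ℝ θ z (e - x • n) =
      (∫ z in D, fderiv ℝ θ z e) - x * T := fun x => by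
    simp only [map_sub, map_smul, smul_eq_mul]
    rw [integral_sub (integrable_fderiv_apply hθ hc e).restrict
      ((integrable_fderiv_apply hθ hc n).restrict.const_mul x), integral_const_mul]
  have hnn : ⟪n, n⟫ = 1 := by rw [real_inner_self_eq_norm_sq, hn, one_pow]
  have hlow := hcone (e - (a - 4 * ε) • n) (by
      refine (norm_sub_le _ _).trans_lt ?_
      rw [he, norm_smul, hn, Real.norm_eq_abs, mul_one]
      have : |a - 4 * ε| < 3 := abs_lt.2 ⟨by linarith, by linarith⟩
      linarith) (by rw [inner_sub_left, inner_smul_left, hnn, ← ha]; simp)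
  have hupp := hcone (-(e - (a + 4 * ε) • n)) (by
      rw [norm_neg]
      refine (norm_sub_le _ _).trans_lt ?_
      rw [he, norm_smul, hn, Real.norm_eq_abs, mul_one]
      have : |a + 4 * ε| < 3 := abs_lt.2 ⟨by linarith, by linarith⟩
      linarith) (by rw [inner_neg_left, inner_sub_left, inner_smul_left, hnn, ← ha]; simp)
  simp only [map_neg, integral_neg] at hupp
  rw [hlin] at hlow hupp
  have hT0 : 0 ≤ T := by
    refine nonneg_of_mul_nonneg_right (hS0.trans hST) (by positivity)
  have h1 : |(∫ z in D, fderiv ℝ θ z e) - a * T| ≤ 4 * ε * S :=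
    abs_le.2 ⟨by nlinarith, by nlinarith⟩
  -- Bernoulli's inequality controls the distortion of surface measure.
  have h2 : |a * T - a * S| ≤ m * ε * S := by
    have hb : 1 - m * ε ≤ (1 - ε) ^ m := by
      have := one_add_mul_le_pow (a := -ε) (by linarith) m
      simpa [sub_eq_add_neg] using this
    have hST' : (1 - ε) ^ m * S ≤ T := by
      rw [inv_pow, inv_mul_eq_div, le_div_iff₀ (by positivity)] at hST
      linarith
    rw [← mul_sub, abs_mul, abs_sub_comm, abs_of_nonneg (sub_nonneg.2 hTS)]
    have : S - T ≤ m * ε * S := by nlinarith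
    nlinarith [sub_nonneg.2 hTS]
  have hfin := h.euclideanHausdorffMeasure_lt_top hD (by linarith) hm hn
  have hθi : Integrable θ (μHE[m].restrict (frontier D)) := by
    obtain ⟨M, hM⟩ := hθ.continuous.bounded_above_of_compact_support hc
    refine IntegrableOn.of_forall_sdiff_eq_zero (s := frontier D ∩ closedBall c r) ?_
      isClosed_frontier.measurableSet fun z hz => ?_
    · exact Measure.integrableOn_of_bounded hfin.ne hθ.continuous.aestronglyMeasurable
        (ae_of_all _ hM)
    · exact image_eq_zero_of_notMem_tsupport fun hz' => hz.2 ⟨hz.1, hs hz'⟩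
  have hνi : Integrable (fun z => θ z * ⟪e, ν z⟫) (μHE[m].restrict (frontier D)) := by
    refine (hθi.const_mul (1 + ε)).mono'
      (hθ.continuous.aestronglyMeasurable.mul (aestronglyMeasurable_const.inner hν))
      ((ae_restrict_iff' isClosed_frontier.measurableSet).2 (ae_of_all _ fun z hz => ?_))
    by_cases hzB : z ∈ closedBall c r
    · rw [norm_mul, Real.norm_eq_abs, abs_of_nonneg (hpos z), mul_comm]
      refine mul_le_mul_of_nonneg_right ((norm_inner_le_norm e _).trans ?_) (hpos z)
      have h4 := norm_add_le (ν z - n) n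
      rw [sub_add_cancel, hn] at h4
      rw [he, one_mul]
      linarith [hνn z ⟨hz, hzB⟩]
    · simp [image_eq_zero_of_notMem_tsupport fun hz' => hzB (hs hz')]
  have h3 : |a * S - ∫ z, θ z * ⟪e, ν z⟫ ∂(μHE[m].restrict (frontier D))| ≤ ε * S := by
    rw [hS, ← integral_const_mul, ← integral_const_mul, ← integral_sub (hθi.const_mul a) hνi]
    rw [← Real.norm_eq_abs]
    refine norm_integral_le_of_norm_le (hθi.const_mul ε) ?_
    refine (ae_restrict_iff' isClosed_frontier.measurableSet).2 (ae_of_all _ fun z hz => ?_)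
    by_cases hzB : z ∈ closedBall c r
    · have : a * θ z - θ z * ⟪e, ν z⟫ = θ z * ⟪e, n - ν z⟫ := by
        rw [inner_sub_right, ← ha]; ring
      rw [this, norm_mul, Real.norm_eq_abs, abs_of_nonneg (hpos z), mul_comm]
      refine mul_le_mul_of_nonneg_right ?_ (hpos z)
      refine (norm_inner_le_norm e _).trans ?_
      rw [he, one_mul, norm_sub_rev]
      exact hνn z ⟨hz, hzB⟩
    · simp [image_eq_zero_of_notMem_tsupport fun hz' => hzB (hs hz')]
  calc _ ≤ |(∫ z in D, fderiv ℝ θ z e) - a * T| + |a * T - a * S| +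
        |a * S - ∫ z, θ z * ⟪e, ν z⟫ ∂(μHE[m].restrict (frontier D))| := by
        refine (abs_sub_le _ (a * S) _).trans ?_
        gcongr
        exact abs_sub_le _ _ _
    _ ≤ _ := by linarith

end Projection

/-! ### The Gauss–Green formula in a constant direction -/

section GaussGreen

variable {E : Type*} [NormedAddCommGroup E] [InnerProductSpace ℝ E] {D : Set E} {ν : E → E} {m : ℕ}

/-- `ν` is a unit normal field along `∂D` in the following geometric sense: near each boundary point
`z`, the set `D` is as close as desired to a half-space with outward normal `ν z`, and `ν` is
continuous along `∂D`. This is what a `C^1` boundary gives. -/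
structure HasUnitNormal (D : Set E) (ν : E → E) : Prop where
  norm_eq : ∀ z ∈ frontier D, ‖ν z‖ = 1
  flat : ∀ z ∈ frontier D, ∀ ε : ℝ, 0 < ε → ∃ r : ℝ, 0 < r ∧ FlatIn D (closedBall z r) (ν z) ε ∧
    ∀ z' ∈ frontier D ∩ closedBall z r, ‖ν z' - ν z‖ ≤ ε

theorem HasUnitNormal.continuousOn (h : HasUnitNormal D ν) : ContinuousOn ν (frontier D) := by
  intro z hz
  refine Metric.continuousWithinAt_iff.2 fun ε hε => ?_
  obtain ⟨r, hr, -, hclose⟩ := h.flat z hz (ε / 2) (by positivity)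
  refine ⟨r, hr, fun z' hz' hd => ?_⟩
  rw [dist_eq_norm]
  linarith [hclose z' ⟨hz', hd.le⟩]

variable [FiniteDimensional ℝ E] [MeasurableSpace E] [BorelSpace E]

theorem HasUnitNormal.aestronglyMeasurable (h : HasUnitNormal D ν) (μ : Measure E) :
    AEStronglyMeasurable ν (μ.restrict (frontier D)) :=
  h.continuousOn.aestronglyMeasurable isClosed_frontier.measurableSet

theorem HasUnitNormal.measure_frontier_lt_top (h : HasUnitNormal D ν) (hD : IsOpen D)
    (hb : Bornology.IsBounded D) (hm : finrank ℝ E = m + 1) : μHE[m] (frontier D) < ⊤ := by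
  have hcpt : IsCompact (frontier D) :=
    hb.isCompact_closure.of_isClosed_subset isClosed_frontier frontier_subset_closure
  refine hcpt.measure_lt_top_of_nhdsWithin fun z hz => ?_
  obtain ⟨r, hr, hflat, -⟩ := h.flat z hz (1 / 2) (by norm_num)
  exact ⟨_, inter_mem_nhdsWithin _ (closedBall_mem_nhds z hr),
    hflat.euclideanHausdorffMeasure_lt_top hD (by norm_num) hm (h.norm_eq z hz)⟩

theorem integral_fderiv_apply_eq_zero {θ : E → ℝ} (hθ : ContDiff ℝ 1 θ) (hc : HasCompactSupport θ)
    (v : E) : ∫ z, fderiv ℝ θ z v = 0 := by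
  have := integral_mul_fderiv_eq_neg_fderiv_mul_of_integrable (μ := (volume : Measure E))
    (f := fun _ : E => (1 : ℝ)) (g := θ) (v := v) (by simp)
    (by simpa using integrable_fderiv_apply hθ hc v)
    (by simpa using hθ.continuous.integrable_of_hasCompactSupport hc)
    (fun _ _ => by fun_prop) (fun _ _ => (hθ.differentiable one_ne_zero).differentiableAt)
  simpa using this

/-- The approximate Gauss–Green formula on the whole domain, by a partition of unity subordinate to
`D` and finitely many balls in which `∂D` is flat. -/
theorem HasUnitNormal.abs_setIntegral_fderiv_sub_le (h : HasUnitNormal D ν) (hD : IsOpen D)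
    (hb : Bornology.IsBounded D) (hm : finrank ℝ E = m + 1) {ψ : E → ℝ} (hψ : ContDiff ℝ 1 ψ)
    (hc : HasCompactSupport ψ) (hpos : ∀ z, 0 ≤ ψ z) {e : E} (he : ‖e‖ = 1) {ε : ℝ} (hε0 : 0 < ε)
    (hε : ε < 1 / 2) :
    |(∫ z in D, fderiv ℝ ψ z e) - ∫ z, ψ z * ⟪e, ν z⟫ ∂(μHE[m].restrict (frontier D))| ≤
      (5 + m) * ε * ∫ z, ψ z ∂(μHE[m].restrict (frontier D)) := by
  have hfin : IsFiniteMeasure ((μHE[m] : Measure E).restrict (frontier D)) :=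
    ⟨by simpa using h.measure_frontier_lt_top hD hb hm⟩
  have hDc : IsCompact (closure D) := hb.isCompact_closure
  have hcpt : IsCompact (frontier D) :=
    hDc.of_isClosed_subset isClosed_frontier frontier_subset_closure
  choose! r hr hflat hclose using fun z hz => h.flat z hz ε hε0
  obtain ⟨t, ht, hcov⟩ := hcpt.elim_nhds_subcover (fun z => ball z (r z))
    fun z hz => ball_mem_nhds z (hr z hz)
  -- The index `none` stands for the interior piece, whose support avoids `∂D`.
  let U : Option t → Set E := fun i => i.elim D fun z => ball (z : E) (r z)
  have hU : ∀ i, IsOpen (U i) := by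
    rintro (_ | z)
    exacts [hD, isOpen_ball]
  have hcovU : closure D ⊆ ⋃ i, U i := by
    intro z hz
    by_cases hzD : z ∈ D
    · exact mem_iUnion.2 ⟨none, hzD⟩
    · have hzF : z ∈ frontier D := by rw [hD.frontier_eq]; exact ⟨hz, hzD⟩
      obtain ⟨w, hw, hzw⟩ := mem_iUnion₂.1 (hcov hzF)
      exact mem_iUnion.2 ⟨some ⟨w, hw⟩, hzw⟩
  obtain ⟨f, hf⟩ := SmoothPartitionOfUnity.exists_isSubordinate (modelWithCornersSelf ℝ E)
    isClosed_closure U hU hcovU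
  set θ : Option t → E → ℝ := fun i z => f i z * ψ z with hθdef
  have hθ : ∀ i, ContDiff ℝ 1 (θ i) := fun i =>
    ((f i).contMDiff.contDiff.of_le (by norm_num)).mul hψ
  have hθc : ∀ i, HasCompactSupport (θ i) := fun i => hc.mul_left
  have hθU : ∀ i, tsupport (θ i) ⊆ U i := fun i =>
    (closure_mono (Function.support_mul_subset_left _ _)).trans (hf i)
  have hθpos : ∀ i z, 0 ≤ θ i z := fun i z => mul_nonneg (f.nonneg i z) (hpos z)
  have hsum : ∀ z ∈ closure D, ψ z = ∑ i, θ i z := fun z hz => by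
    have h1 := f.sum_eq_one hz
    rw [finsum_eq_sum_of_fintype] at h1
    simp only [hθdef]
    rw [← Finset.sum_mul, h1, one_mul]
  have hbdd : ∀ g : E → ℝ, Continuous g → HasCompactSupport g →
      Integrable g (μHE[m].restrict (frontier D)) := fun g hg hgc => by
    obtain ⟨M, hM⟩ := hg.bounded_above_of_compact_support hgc
    exact Integrable.of_bound hg.aestronglyMeasurable M (ae_of_all _ hM)
  have hint : ∀ i, Integrable (fun z => θ i z * ⟪e, ν z⟫) (μHE[m].restrict (frontier D)) :=
    fun i => by
      refine (hbdd (θ i) (hθ i).continuous (hθc i)).mono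
        ((hθ i).continuous.aestronglyMeasurable.mul
          (aestronglyMeasurable_const.inner (h.aestronglyMeasurable _)))
        ((ae_restrict_iff' isClosed_frontier.measurableSet).2 (ae_of_all _ fun z hz => ?_))
      rw [norm_mul]
      refine mul_le_of_le_one_right (norm_nonneg _) ((norm_inner_le_norm e _).trans ?_)
      rw [he, h.norm_eq z hz, one_mul]
  have hpiece : ∀ i,
      |(∫ z in D, fderiv ℝ (θ i) z e) - ∫ z, θ i z * ⟪e, ν z⟫ ∂(μHE[m].restrict (frontier D))| ≤
        (5 + m) * ε * ∫ z, θ i z ∂(μHE[m].restrict (frontier D)) := by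
    rintro (_ | z)
    · have hz0 : ∀ z ∈ frontier D, θ none z = 0 := fun z hz => by
        rw [hD.frontier_eq] at hz
        exact image_eq_zero_of_notMem_tsupport fun hz' => hz.2 (hθU none hz')
      have h1 : ∫ z, θ none z * ⟪e, ν z⟫ ∂(μHE[m].restrict (frontier D)) = 0 :=
        setIntegral_eq_zero_of_forall_eq_zero fun z hz => by rw [hz0 z hz, zero_mul]
      have h2 : ∫ z in D, fderiv ℝ (θ none) z e = 0 := by
        rw [setIntegral_eq_integral_of_forall_compl_eq_zero,
          integral_fderiv_apply_eq_zero (hθ none) (hθc none)]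
        intro z hz
        rw [image_eq_zero_of_notMem_tsupport
          fun h' => hz (hθU none (tsupport_fderiv_subset ℝ h'))]
        rfl
      rw [h1, h2, sub_zero, abs_zero]
      exact mul_nonneg (by positivity) (integral_nonneg (hθpos none))
    · have hz := ht z z.2
      exact (hflat z hz).abs_setIntegral_fderiv_sub_le hD hε0 hε hm (h.norm_eq z hz) (hθ _) (hθc _)
        ((hθU (some z)).trans (ball_subset_closedBall (x := (z : E)) (ε := r z))) (hθpos _) he
        (h.aestronglyMeasurable _)
        (hclose z hz)
  have h1 : ∫ z in D, fderiv ℝ ψ z e = ∑ i, ∫ z in D, fderiv ℝ (θ i) z e := by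
    rw [← integral_finsetSum _ fun i _ => (integrable_fderiv_apply (hθ i) (hθc i) e).restrict]
    refine setIntegral_congr_fun hD.measurableSet fun z hz => ?_
    have heq : ψ =ᶠ[𝓝 z] fun w => ∑ i, θ i w := by
      filter_upwards [hD.mem_nhds hz] with w hw using hsum w (subset_closure hw)
    rw [heq.fderiv_eq, fderiv_fun_sum fun i _ =>
      ((hθ i).differentiable one_ne_zero).differentiableAt]
    simp
  have h2 : ∫ z, ψ z * ⟪e, ν z⟫ ∂(μHE[m].restrict (frontier D)) =
      ∑ i, ∫ z, θ i z * ⟪e, ν z⟫ ∂(μHE[m].restrict (frontier D)) := by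
    rw [← integral_finsetSum _ fun i _ => hint i]
    refine setIntegral_congr_fun isClosed_frontier.measurableSet fun z hz => ?_
    rw [hsum z (frontier_subset_closure hz), Finset.sum_mul]
  have h3 : ∫ z, ψ z ∂(μHE[m].restrict (frontier D)) =
      ∑ i, ∫ z, θ i z ∂(μHE[m].restrict (frontier D)) := by
    rw [← integral_finsetSum _ fun i _ => hbdd _ (hθ i).continuous (hθc i)]
    exact setIntegral_congr_fun isClosed_frontier.measurableSet fun z hz =>
      hsum z (frontier_subset_closure hz)
  rw [h1, h2, h3, ← Finset.sum_sub_distrib, Finset.mul_sum]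
  exact (Finset.abs_sum_le_sum_abs _ _).trans (Finset.sum_le_sum fun i _ => hpiece i)

/-- **Gauss–Green formula** for a constant direction and a nonnegative density, from the
approximate formula as `ε → 0`. -/
theorem HasUnitNormal.setIntegral_fderiv_eq (h : HasUnitNormal D ν) (hD : IsOpen D)
    (hb : Bornology.IsBounded D) (hm : finrank ℝ E = m + 1) {ψ : E → ℝ} (hψ : ContDiff ℝ 1 ψ)
    (hc : HasCompactSupport ψ) (hpos : ∀ z, 0 ≤ ψ z) (v : E) :
    ∫ z in D, fderiv ℝ ψ z v = ∫ z, ψ z * ⟪v, ν z⟫ ∂(μHE[m].restrict (frontier D)) := by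
  rcases eq_or_ne v 0 with rfl | hv0
  · simp
  have hvp : 0 < ‖v‖ := norm_pos_iff.2 hv0
  set e : E := ‖v‖⁻¹ • v with he
  have hen : ‖e‖ = 1 := by
    rw [he, norm_smul, norm_inv, norm_norm, inv_mul_cancel₀ hvp.ne']
  have hve : v = ‖v‖ • e := by rw [he, smul_smul, mul_inv_cancel₀ hvp.ne', one_smul]
  have key : ∫ z in D, fderiv ℝ ψ z e =
      ∫ z, ψ z * ⟪e, ν z⟫ ∂(μHE[m].restrict (frontier D)) := by
    rw [← sub_eq_zero, ← abs_nonpos_iff]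
    set S := ∫ z, ψ z ∂(μHE[m].restrict (frontier D))
    have hlim : Tendsto (fun ε : ℝ => (5 + m) * ε * S) (𝓝[>] 0) (𝓝 ((5 + m) * 0 * S)) :=
      ((continuous_const.mul continuous_id).mul continuous_const).continuousWithinAt
    rw [mul_zero, zero_mul] at hlim
    refine ge_of_tendsto hlim ?_
    filter_upwards [Ioo_mem_nhdsGT (show (0 : ℝ) < 1 / 2 by norm_num)] with ε hε
    exact h.abs_setIntegral_fderiv_sub_le hD hb hm hψ hc hpos hen hε.1 hε.2
  have h1 : ∀ z, fderiv ℝ ψ z v = ‖v‖ * fderiv ℝ ψ z e := fun z => by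
    conv_lhs => rw [hve]
    simp
  have h2 : ∀ z, ψ z * ⟪v, ν z⟫ = ‖v‖ * (ψ z * ⟪e, ν z⟫) := fun z => by
    conv_lhs => rw [hve]
    rw [inner_smul_left]
    simp only [conj_trivial]
    ring
  simp_rw [h1, h2]
  rw [integral_const_mul, integral_const_mul, key]

end GaussGreen

/-! ### Unit normals of `C^1` domains -/

namespace Grushin

variable {N l : ℕ} {D : Set (Space N l)}

theorem inner_gradient (ρ : Space N l → ℝ) (z v : Space N l) :
    ⟪gradient ρ z, v⟫ = fderiv ℝ ρ z v :=
  InnerProductSpace.toDual_symm_apply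

theorem continuousAt_gradient {ρ : Space N l → ℝ} {z : Space N l} (h : ContDiffAt ℝ 1 ρ z) :
    ContinuousAt (gradient ρ) z :=
  (InnerProductSpace.toDual ℝ (Space N l)).symm.continuous.continuousAt.comp
    (h.continuousAt_fderiv one_ne_zero)

section DefiningFunction

variable {z w : Space N l} {U : Set (Space N l)} {ρ : Space N l → ℝ}

theorem IsDefiningFunction.contDiffAt (h : IsDefiningFunction D z U ρ) (hw : w ∈ U) :
    ContDiffAt ℝ 1 ρ w :=
  h.contDiffOn.contDiffAt (h.isOpen.mem_nhds hw)

theorem IsDefiningFunction.mem_iff (h : IsDefiningFunction D z U ρ) (hw : w ∈ U) :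
    w ∈ D ↔ ρ w < 0 := by
  have := Set.ext_iff.1 h.inter_eq w
  simpa [hw] using this

theorem IsDefiningFunction.nonpos (h : IsDefiningFunction D z U ρ) (hw : w ∈ closure D)
    (hwU : w ∈ U) : ρ w ≤ 0 := by
  by_contra! hpos
  have h1 : ∀ᶠ y in 𝓝 w, 0 < ρ y :=
    (h.contDiffAt hwU).continuousAt.eventually (lt_mem_nhds hpos)
  obtain ⟨y, hyD, hy1, hyU⟩ := ((mem_closure_iff_frequently.1 hw).and_eventually
    (h1.and (h.isOpen.mem_nhds hwU))).exists
  exact lt_asymm hy1 ((h.mem_iff hyU).1 hyD)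

theorem IsDefiningFunction.eq_zero (h : IsDefiningFunction D z U ρ) (hD : IsOpen D)
    (hw : w ∈ frontier D) (hwU : w ∈ U) : ρ w = 0 := by
  rw [hD.frontier_eq] at hw
  exact le_antisymm (h.nonpos hw.1 hwU) (not_lt.1 fun hneg => hw.2 ((h.mem_iff hwU).2 hneg))

theorem IsDefiningFunction.eventually_pos (h : IsDefiningFunction D z U ρ) (hD : IsOpen D)
    (hz : z ∈ frontier D) {v : Space N l} (hv : 0 < ⟪gradient ρ z, v⟫) :
    ∀ᶠ t : ℝ in 𝓝[>] 0, 0 < ρ (z + t • v) := by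
  have h1 : HasDerivAt (fun t : ℝ => z + t • v) v 0 := by
    simpa using ((hasDerivAt_id (0 : ℝ)).smul_const v).const_add z
  have h2 : HasDerivAt (fun t : ℝ => ρ (z + t • v)) ⟪gradient ρ z, v⟫ 0 := by
    rw [inner_gradient]
    refine HasFDerivAt.comp_hasDerivAt (0 : ℝ) ?_ h1
    simpa using ((h.contDiffAt h.mem).differentiableAt one_ne_zero).hasFDerivAt
  have h3 := (hasDerivAt_iff_tendsto_slope.1 h2).mono_left
    (nhdsWithin_mono 0 fun t (ht : 0 < t) => ht.ne')
  filter_upwards [h3.eventually (lt_mem_nhds hv), self_mem_nhdsWithin] with t ht ht0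
  rw [slope_def_field, zero_smul, add_zero, h.eq_zero hD hz h.mem, sub_zero, sub_zero] at ht
  exact (div_pos_iff_of_pos_right ht0).1 ht

theorem IsDefiningFunction.eventually_neg (h : IsDefiningFunction D z U ρ) (hD : IsOpen D)
    (hz : z ∈ frontier D) {v : Space N l} (hv : ⟪gradient ρ z, v⟫ < 0) :
    ∀ᶠ t : ℝ in 𝓝[>] 0, ρ (z + t • v) < 0 := by
  have h1 : HasDerivAt (fun t : ℝ => z + t • v) v 0 := by
    simpa using ((hasDerivAt_id (0 : ℝ)).smul_const v).const_add z
  have h2 : HasDerivAt (fun t : ℝ => ρ (z + t • v)) ⟪gradient ρ z, v⟫ 0 := by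
    rw [inner_gradient]
    refine HasFDerivAt.comp_hasDerivAt (0 : ℝ) ?_ h1
    simpa using ((h.contDiffAt h.mem).differentiableAt one_ne_zero).hasFDerivAt
  have h3 := (hasDerivAt_iff_tendsto_slope.1 h2).mono_left
    (nhdsWithin_mono 0 fun t (ht : 0 < t) => ht.ne')
  filter_upwards [h3.eventually (gt_mem_nhds hv), self_mem_nhdsWithin] with t ht ht0
  rw [slope_def_field, zero_smul, add_zero, h.eq_zero hD hz h.mem, sub_zero, sub_zero] at ht
  exact (div_neg_iff.1 ht).elim (fun h => absurd h.2 (not_lt.2 (le_of_lt ht0))) And.left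

theorem norm_inv_norm_smul {g : Space N l} (hg : g ≠ 0) : ‖‖g‖⁻¹ • g‖ = 1 := by
  rw [norm_smul, norm_inv, norm_norm, inv_mul_cancel₀ (norm_ne_zero_iff.2 hg)]

theorem IsOutwardUnitNormal.norm_eq {n : Space N l} (h : IsOutwardUnitNormal D z n) : ‖n‖ = 1 := by
  obtain ⟨U, ρ, hρ, rfl⟩ := h
  exact norm_inv_norm_smul hρ.gradient_ne_zero

/-- The outward unit normal does not depend on the defining function: if `n₁ ≠ n₂`, then the
direction `n₂ - n₁` points into `D` according to `n₁` and out of `D` according to `n₂`. -/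
theorem IsOutwardUnitNormal.unique {n₁ n₂ : Space N l} (h₁ : IsOutwardUnitNormal D z n₁)
    (h₂ : IsOutwardUnitNormal D z n₂) (hD : IsOpen D) (hz : z ∈ frontier D) : n₁ = n₂ := by
  by_contra hne
  have hn₁ := h₁.norm_eq
  have hn₂ := h₂.norm_eq
  have hlt : ⟪n₁, n₂⟫ < 1 := (inner_lt_one_iff_real_of_norm_eq_one hn₁ hn₂).2 hne
  obtain ⟨U₁, ρ₁, hρ₁, e₁⟩ := h₁
  obtain ⟨U₂, ρ₂, hρ₂, e₂⟩ := h₂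
  have g₁ : gradient ρ₁ z = ‖gradient ρ₁ z‖ • n₁ := by
    rw [e₁, smul_smul, mul_inv_cancel₀ (norm_ne_zero_iff.2 hρ₁.gradient_ne_zero), one_smul]
  have g₂ : gradient ρ₂ z = ‖gradient ρ₂ z‖ • n₂ := by
    rw [e₂, smul_smul, mul_inv_cancel₀ (norm_ne_zero_iff.2 hρ₂.gradient_ne_zero), one_smul]
  have p₁ : 0 < ‖gradient ρ₁ z‖ := norm_pos_iff.2 hρ₁.gradient_ne_zero
  have p₂ : 0 < ‖gradient ρ₂ z‖ := norm_pos_iff.2 hρ₂.gradient_ne_zero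
  have hneg := hρ₁.eventually_neg hD hz (v := n₂ - n₁) (by
    rw [g₁, inner_smul_left, inner_sub_right, real_inner_self_eq_norm_sq, hn₁]
    exact mul_neg_of_pos_of_neg p₁ (by linarith))
  have hpos := hρ₂.eventually_pos hD hz (v := n₂ - n₁) (by
    rw [g₂, inner_smul_left, inner_sub_right, real_inner_self_eq_norm_sq, hn₂, real_inner_comm]
    exact mul_pos p₂ (by linarith))
  have hcont : Tendsto (fun t : ℝ => z + t • (n₂ - n₁)) (𝓝[>] 0) (𝓝 z) := by
    have : Continuous fun t : ℝ => z + t • (n₂ - n₁) := by fun_prop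
    simpa using (this.tendsto 0).mono_left nhdsWithin_le_nhds
  obtain ⟨t, ht₁, ht₂, hU₁, hU₂⟩ := (hneg.and (hpos.and
    ((hcont.eventually (hρ₁.isOpen.mem_nhds hρ₁.mem)).and
      (hcont.eventually (hρ₂.isOpen.mem_nhds hρ₂.mem))))).exists
  exact lt_asymm ht₂ ((hρ₂.mem_iff hU₂).1 ((hρ₁.mem_iff hU₁).2 ht₁))

end DefiningFunction

/-- Strict differentiability of a defining function `ρ` at `z` makes `D` flat near `z`. The normal is
continuous because, by `IsOutwardUnitNormal.unique`, one defining function computes the normals at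
all boundary points near `z`. -/
theorem hasUnitNormal {ν : Space N l → Space N l} (hD : IsOpen D)
    (hν : ∀ z ∈ frontier D, IsOutwardUnitNormal D z (ν z)) : HasUnitNormal D ν := by
  refine ⟨fun z hz => (hν z hz).norm_eq, fun z hz ε hε => ?_⟩
  obtain ⟨U, ρ, hρ, hνz⟩ := hν z hz
  have hg := hρ.gradient_ne_zero
  have hgp : 0 < ‖gradient ρ z‖ := norm_pos_iff.2 hg
  have hstrict := (hρ.contDiffAt hρ.mem).hasStrictFDerivAt one_ne_zero
  have h1 := hstrict.isLittleO.def (mul_pos hε hgp)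
  rw [nhds_prod_eq] at h1
  obtain ⟨V, hV, hVρ⟩ := (Filter.eventually_prod_self_iff (r := fun a b =>
    ‖ρ a - ρ b - fderiv ℝ ρ z (a - b)‖ ≤ ε * ‖gradient ρ z‖ * ‖a - b‖)).1 h1
  have hcg := continuousAt_gradient (hρ.contDiffAt hρ.mem)
  have hcn : ContinuousAt (fun w => ‖gradient ρ w‖⁻¹ • gradient ρ w) z :=
    (hcg.norm.inv₀ hgp.ne').smul hcg
  have h2 := Metric.continuousAt_iff'.1 hcn ε hε
  have h3 := hcg.eventually (isOpen_ne.mem_nhds hg)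
  obtain ⟨r, hr, hball⟩ := Metric.nhds_basis_closedBall.eventually_iff.1
    (h2.and (h3.and ((eventually_mem_set.2 (hρ.isOpen.mem_nhds hρ.mem)).and
      (eventually_mem_set.2 hV))))
  refine ⟨r, hr, fun w hw w' hw' hcl hlt => ?_, fun w hw => ?_⟩
  · obtain ⟨-, -, hwU, hwV⟩ := hball hw
    obtain ⟨-, -, hwU', hwV'⟩ := hball hw'
    have h4 := hVρ w' hwV' w hwV
    simp only [← inner_gradient] at h4
    have h5 := hρ.nonpos hcl hwU'
    have h6 : ⟪gradient ρ z, w' - w⟫ = ‖gradient ρ z‖ * ⟪w' - w, ν z⟫ := by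
      rw [hνz, inner_smul_right, real_inner_comm, mul_inv_cancel_left₀ hgp.ne']
    rw [h6, Real.norm_eq_abs] at h4
    rw [hρ.mem_iff hwU]
    have h7 := mul_lt_mul_of_pos_left hlt hgp
    have h8 := (abs_le.1 h4).1
    nlinarith
  · obtain ⟨hc, hne, hwU, -⟩ := hball hw.2
    have hdef : IsOutwardUnitNormal D w (‖gradient ρ w‖⁻¹ • gradient ρ w) :=
      ⟨U, ρ, ⟨hρ.isOpen, hwU, hρ.contDiffOn, hne, hρ.inter_eq⟩, rfl⟩
    rw [(hν w hw.1).unique hdef hD hw.1, hνz, ← dist_eq_norm]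
    exact hc.le

end Grushin

/-! ### The divergence theorem for continuous fields -/

section WeakDivergence

variable {E : Type*} [NormedAddCommGroup E] [InnerProductSpace ℝ E] [FiniteDimensional ℝ E]
  [MeasurableSpace E] [BorelSpace E]

/-- A sequence of bump functions shrinking to the origin. -/
noncomputable def shrinkingBump (E : Type*) [NormedAddCommGroup E] [InnerProductSpace ℝ E]
    (δ : ℝ) (hδ : 0 < δ) (i : ℕ) : ContDiffBump (0 : E) where
  rIn := δ / (i + 1) / 2
  rOut := δ / (i + 1)
  rIn_pos := by positivity
  rIn_lt_rOut := half_lt_self (by positivity)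

variable {δ : ℝ} (hδ : 0 < δ)

omit [FiniteDimensional ℝ E] [MeasurableSpace E] [BorelSpace E] in
theorem shrinkingBump_rOut_le (i : ℕ) : (shrinkingBump E δ hδ i).rOut ≤ δ :=
  div_le_self hδ.le (by simp)

omit [FiniteDimensional ℝ E] [MeasurableSpace E] [BorelSpace E] in
theorem tendsto_shrinkingBump_rOut :
    Tendsto (fun i => (shrinkingBump E δ hδ i).rOut) atTop (𝓝 0) := by
  have := tendsto_one_div_add_atTop_nhds_zero_nat.const_mul δ
  simpa [shrinkingBump, div_eq_mul_inv] using this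

/-- The smooth approximation `ρ_i * 1_D` of the indicator function of `D`. -/
noncomputable def mollifiedIndicator (D : Set E) (i : ℕ) : E → ℝ :=
  (shrinkingBump E δ hδ i).normed volume ⋆[ContinuousLinearMap.lsmul ℝ ℝ, volume]
    (D.indicator fun _ => (1 : ℝ))

variable {D : Set E} {ν : E → E} {m : ℕ}

theorem locallyIntegrable_indicator_one (hD : IsOpen D) :
    LocallyIntegrable (D.indicator fun _ => (1 : ℝ)) := by
  exact (locallyIntegrable_const (1 : ℝ)).indicator hD.measurableSet

theorem contDiff_mollifiedIndicator (hD : IsOpen D) (i : ℕ) :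
    ContDiff ℝ ∞ (mollifiedIndicator hδ D i) :=
  (shrinkingBump E δ hδ i).hasCompactSupport_normed.contDiff_convolution_left _
    (shrinkingBump E δ hδ i).contDiff_normed (locallyIntegrable_indicator_one hD)

theorem mollifiedIndicator_apply (hD : IsOpen D) (i : ℕ) (z : E) :
    mollifiedIndicator hδ D i z = ∫ y in D, (shrinkingBump E δ hδ i).normed volume (z - y) := by
  rw [mollifiedIndicator, convolution_eq_swap, ← integral_indicator hD.measurableSet]
  congr 1 with y
  by_cases hy : y ∈ D <;> simp [hy]

theorem normed_sub_comm (φ : ContDiffBump (0 : E)) (y z : E) :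
    φ.normed volume (z - y) = φ.normed volume (y - z) := by
  rw [← neg_sub, φ.normed_neg]

theorem normed_sub_eq_zero (φ : ContDiffBump (0 : E)) {y z : E} (h : φ.rOut ≤ dist z y) :
    φ.normed volume (z - y) = 0 := by
  rw [← Function.notMem_support, φ.support_normed_eq]
  simpa [dist_eq_norm] using h

theorem integral_normed_sub (φ : ContDiffBump (0 : E)) (z : E) :
    ∫ y, φ.normed volume (z - y) = 1 := by
  rw [integral_sub_left_eq_self (φ.normed volume) volume z, φ.integral_normed]

theorem integrable_normed_sub (φ : ContDiffBump (0 : E)) (z : E) :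
    Integrable fun y => φ.normed volume (z - y) :=
  φ.integrable_normed.comp_sub_left z

theorem norm_normed_convolution_le {F : Type*} [NormedAddCommGroup F] [NormedSpace ℝ F]
    (φ : ContDiffBump (0 : E)) {g : E → F} {M : ℝ} (hM : ∀ z, ‖g z‖ ≤ M) (z : E) :
    ‖(φ.normed volume ⋆[ContinuousLinearMap.lsmul ℝ ℝ, volume] g) z‖ ≤ M := by
  rw [convolution_eq_swap]
  refine (norm_integral_le_of_norm_le ((integrable_normed_sub φ z).mul_const M)
    (ae_of_all _ fun t => ?_)).trans_eq ?_
  · rw [ContinuousLinearMap.lsmul_apply, norm_smul, Real.norm_eq_abs,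
      abs_of_nonneg (φ.nonneg_normed _)]
    exact mul_le_mul_of_nonneg_left (hM t) (φ.nonneg_normed _)
  · rw [integral_mul_const, integral_normed_sub, one_mul]

theorem mollifiedIndicator_nonneg (hD : IsOpen D) (i : ℕ) (z : E) :
    0 ≤ mollifiedIndicator hδ D i z := by
  rw [mollifiedIndicator_apply hδ hD]
  exact integral_nonneg fun y => ContDiffBump.nonneg_normed _ _

theorem mollifiedIndicator_le_one (hD : IsOpen D) (i : ℕ) (z : E) :
    mollifiedIndicator hδ D i z ≤ 1 := by
  rw [mollifiedIndicator_apply hδ hD, ← integral_normed_sub (shrinkingBump E δ hδ i) z]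
  exact setIntegral_le_integral (integrable_normed_sub _ _)
    (ae_of_all _ fun y => ContDiffBump.nonneg_normed _ _)

theorem mollifiedIndicator_eq_zero (hD : IsOpen D) (i : ℕ) {z : E} (hz : z ∉ cthickening δ D) :
    mollifiedIndicator hδ D i z = 0 := by
  rw [mollifiedIndicator_apply hδ hD]
  refine setIntegral_eq_zero_of_forall_eq_zero fun y hy => normed_sub_eq_zero _ ?_
  by_contra! hlt
  exact hz (mem_cthickening_of_dist_le z y δ D hy (hlt.le.trans (shrinkingBump_rOut_le hδ i)))

theorem tsupport_mollifiedIndicator_subset (hD : IsOpen D) (i : ℕ) :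
    tsupport (mollifiedIndicator hδ D i) ⊆ cthickening δ D := by
  refine closure_minimal (fun z hz => ?_) isClosed_cthickening
  by_contra hz'
  exact hz (mollifiedIndicator_eq_zero hδ hD i hz')

theorem ae_tendsto_mollifiedIndicator (hD : IsOpen D) :
    ∀ᵐ z, Tendsto (fun i => mollifiedIndicator hδ D i z) atTop
      (𝓝 (D.indicator (fun _ => (1 : ℝ)) z)) :=
  ContDiffBump.ae_convolution_tendsto_right_of_locallyIntegrable (K := 2)
    (tendsto_shrinkingBump_rOut hδ)
    (Eventually.of_forall fun i => by simp [shrinkingBump]; linarith)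
    (locallyIntegrable_indicator_one hD)

/-- By the Gauss–Green formula for the constant direction `v`, the derivative of `ρ_i * 1_D` is
the mollification of the vector measure `-ν dS`. -/
theorem HasUnitNormal.fderiv_mollifiedIndicator (h : HasUnitNormal D ν) (hD : IsOpen D)
    (hb : Bornology.IsBounded D) (hm : finrank ℝ E = m + 1) (i : ℕ) (z v : E) :
    fderiv ℝ (mollifiedIndicator hδ D i) z v =
      -∫ y, (shrinkingBump E δ hδ i).normed volume (z - y) * ⟪v, ν y⟫
        ∂(μHE[m].restrict (frontier D)) := by
  set φ := shrinkingBump E δ hδ i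
  have hφ : ContDiff ℝ 1 (φ.normed (volume : Measure E)) := φ.contDiff_normed
  have hφc : HasCompactSupport (φ.normed (volume : Measure E)) := φ.hasCompactSupport_normed
  have h1 := hφc.hasFDerivAt_convolution_left (ContinuousLinearMap.lsmul ℝ ℝ) hφ
    (locallyIntegrable_indicator_one hD) z
  have h2 : fderiv ℝ (mollifiedIndicator hδ D i) z v =
      ∫ y in D, fderiv ℝ (φ.normed volume) (z - y) v := by
    rw [mollifiedIndicator, h1.fderiv, convolution_eq_swap]
    have hint : Integrable fun y => ((ContinuousLinearMap.lsmul ℝ ℝ).precompL E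
        (fderiv ℝ (φ.normed volume) (z - y))) (D.indicator (fun _ => (1 : ℝ)) y) := by
      have h3 : ConvolutionExistsAt (fderiv ℝ (φ.normed (volume : Measure E)))
          (D.indicator fun _ => (1 : ℝ)) z ((ContinuousLinearMap.lsmul ℝ ℝ).precompL E) volume :=
        (hφc.fderiv ℝ).convolutionExists_left _ (hφ.continuous_fderiv one_ne_zero)
          (locallyIntegrable_indicator_one hD) z
      exact convolutionExistsAt_iff_integrable_swap.1 h3
    rw [ContinuousLinearMap.integral_apply hint, ← integral_indicator hD.measurableSet]
    congr 1 with y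
    by_cases hy : y ∈ D <;> simp [hy]
  rw [h2]
  have hψ : ContDiff ℝ 1 fun y => φ.normed volume (z - y) := hφ.comp (by fun_prop)
  have hψc : HasCompactSupport fun y => φ.normed volume (z - y) :=
    hφc.comp_homeomorph (Homeomorph.subLeft z)
  rw [← h.setIntegral_fderiv_eq hD hb hm hψ hψc (fun y => φ.nonneg_normed _) v, ← integral_neg]
  congr 1 with y
  have h4 : HasFDerivAt (fun y => φ.normed volume (z - y))
      ((fderiv ℝ (φ.normed volume) (z - y)).comp (-ContinuousLinearMap.id ℝ E)) y :=
    ((hφ.differentiable one_ne_zero).differentiableAt.hasFDerivAt).comp y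
      ((hasFDerivAt_id y).const_sub z)
  rw [h4.fderiv]
  simp

/-- **Divergence theorem** for a continuous vector field `V` whose distributional divergence is a
locally integrable function `w`, on a domain with `C^1` boundary. -/
theorem HasUnitNormal.setIntegral_eq_of_weak_divergence (h : HasUnitNormal D ν) (hD : IsOpen D)
    (hb : Bornology.IsBounded D) (hm : finrank ℝ E = m + 1) {Ω : Set E} (hΩ : IsOpen Ω)
    (hDΩ : closure D ⊆ Ω) {V : E → E} (hV : ContinuousOn V Ω) {w : E → ℝ}
    (hw : LocallyIntegrableOn w Ω)
    (hweak : ∀ η : E → ℝ, ContDiff ℝ ∞ η → HasCompactSupport η → tsupport η ⊆ Ω → (∀ z, 0 ≤ η z) →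
      ∫ z, fderiv ℝ η z (V z) = -∫ z, w z * η z) :
    ∫ z in D, w z = ∫ z, ⟪V z, ν z⟫ ∂(μHE[m].restrict (frontier D)) := by
  have hfin : IsFiniteMeasure ((μHE[m] : Measure E).restrict (frontier D)) :=
    ⟨by simpa using h.measure_frontier_lt_top hD hb hm⟩
  have hDc : IsCompact (closure D) := hb.isCompact_closure
  obtain ⟨δ, hδ, hδΩ⟩ := hDc.exists_cthickening_subset_open hΩ hDΩ
  rw [cthickening_closure] at hδΩ
  set K := cthickening δ D with hK
  have hKc : IsCompact K := hb.cthickening.isCompact_closure.of_isClosed_subset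
    isClosed_cthickening subset_closure
  have hDK : D ⊆ K := self_subset_cthickening D
  have hwK : IntegrableOn w K := hw.integrableOn_compact_subset hδΩ hKc
  obtain ⟨M, hM⟩ := hKc.exists_bound_of_continuousOn (hV.mono hδΩ)
  -- Outside `Ω` nothing is known of `V`, so it is cut off outside a neighbourhood of `closure D`.
  set V₀ : E → E := K.indicator V with hV₀
  have hV₀m : AEStronglyMeasurable V₀ volume :=
    (aestronglyMeasurable_indicator_iff hKc.measurableSet).2
      ((hV.mono hδΩ).aestronglyMeasurable hKc.measurableSet)
  have hM' : ∀ z, ‖V₀ z‖ ≤ |M| := fun z => by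
    by_cases hz : z ∈ K
    · simpa [hV₀, hz] using (hM z hz).trans (le_abs_self M)
    · simp [hV₀, hz]
  have hV₀i : Integrable V₀ := by
    refine (integrable_indicator_iff hKc.measurableSet).2 ?_
    exact (hV.mono hδΩ).integrableOn_compact hKc
  have hKnhds : ∀ y ∈ closure D, K ∈ 𝓝 y := fun y hy =>
    mem_of_superset (isOpen_thickening.mem_nhds ((closure_subset_thickening hδ D) hy))
      (thickening_subset_cthickening δ D)
  set φ : ℕ → ContDiffBump (0 : E) := shrinkingBump E δ hδ
  have hνm := h.aestronglyMeasurable (μHE[m] : Measure E)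
  -- Testing with the mollified indicator and Fubini's theorem move the mollification to `V₀`.
  have key : ∀ i, ∫ z, w z * mollifiedIndicator hδ D i z =
      ∫ y, ⟪((φ i).normed volume ⋆[ContinuousLinearMap.lsmul ℝ ℝ, volume] V₀) y, ν y⟫
        ∂(μHE[m].restrict (frontier D)) := fun i => by
    have h1 := hweak _ (contDiff_mollifiedIndicator hδ hD i)
      (hKc.of_isClosed_subset (isClosed_tsupport _) (tsupport_mollifiedIndicator_subset hδ hD i))
      ((tsupport_mollifiedIndicator_subset hδ hD i).trans hδΩ) (mollifiedIndicator_nonneg hδ hD i)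
    rw [← neg_inj, ← h1]
    have h2 : ∀ z, fderiv ℝ (mollifiedIndicator hδ D i) z (V z) =
        -∫ y, (φ i).normed volume (z - y) * ⟪V₀ z, ν y⟫ ∂(μHE[m].restrict (frontier D)) :=
      fun z => by
        by_cases hz : z ∈ K
        · simp only [hV₀, indicator_of_mem hz]
          exact h.fderiv_mollifiedIndicator hδ hD hb hm i z (V z)
        · rw [image_eq_zero_of_notMem_tsupport fun h' =>
            hz (tsupport_mollifiedIndicator_subset hδ hD i (tsupport_fderiv_subset ℝ h'))]
          simp [hV₀, hz]
    simp_rw [h2]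
    rw [integral_neg, neg_inj, integral_integral_swap]
    · refine integral_congr_ae (ae_of_all _ fun y => ?_)
      simp only
      rw [convolution_eq_swap]
      have hint : Integrable fun t => (φ i).normed volume (y - t) • V₀ t :=
        (((φ i).continuous_normed.comp
          (by fun_prop : Continuous fun t => y - t)).integrable_of_hasCompactSupport
            ((φ i).hasCompactSupport_normed.comp_homeomorph (Homeomorph.subLeft y))).smul_bdd |M|
              hV₀m (ae_of_all _ hM')
      simp only [ContinuousLinearMap.lsmul_apply]
      rw [real_inner_comm, ← integral_inner hint]
      congr 1 with z
      rw [inner_smul_right, normed_sub_comm, real_inner_comm]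
    · obtain ⟨C, hC⟩ := (φ i).continuous_normed.bounded_above_of_compact_support
        ((φ i).hasCompactSupport_normed (μ := (volume : Measure E)))
      have hbase : Integrable (fun q : E × E => ‖V₀ q.1‖ * C)
          (volume.prod (μHE[m].restrict (frontier D))) := by
        exact hV₀i.norm.mul_prod (integrable_const C)
      refine hbase.mono' ?_ ?_
      · refine AEStronglyMeasurable.mul ?_ (hV₀m.comp_fst.inner hνm.comp_snd)
        exact ((φ i).continuous_normed.comp
          (by fun_prop : Continuous fun q : E × E => q.1 - q.2)).aestronglyMeasurable
      · have : ∀ᵐ q : E × E ∂(volume.prod (μHE[m].restrict (frontier D))), q.2 ∈ frontier D :=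
          Measure.quasiMeasurePreserving_snd.ae
            (ae_restrict_mem isClosed_frontier.measurableSet)
        filter_upwards [this] with q hq
        simp only [Function.uncurry, norm_mul]
        have h3 := norm_inner_le_norm (𝕜 := ℝ) (V₀ q.1) (ν q.2)
        rw [h.norm_eq _ hq, mul_one] at h3
        rw [mul_comm]
        exact mul_le_mul h3 (hC _) (norm_nonneg _) (norm_nonneg _)
  have hlim1 : Tendsto (fun i => ∫ z, w z * mollifiedIndicator hδ D i z) atTop
      (𝓝 (∫ z in D, w z)) := by
    have h1 : ∫ z in D, w z = ∫ z in K, w z * D.indicator (fun _ => (1 : ℝ)) z := by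
      rw [← integral_indicator hD.measurableSet, ← integral_indicator hKc.measurableSet]
      congr 1 with z
      by_cases hz : z ∈ D
      · simp [hz, hDK hz]
      · by_cases hz' : z ∈ K <;> simp [hz, hz']
    have h2 : ∀ i, ∫ z, w z * mollifiedIndicator hδ D i z =
        ∫ z in K, w z * mollifiedIndicator hδ D i z := fun i =>
      (setIntegral_eq_integral_of_forall_compl_eq_zero fun z hz => by
        rw [mollifiedIndicator_eq_zero hδ hD i hz, mul_zero]).symm
    simp_rw [h1, h2]
    refine tendsto_integral_of_dominated_convergence (fun z => ‖w z‖) (fun i => ?_) hwK.norm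
      (fun i => ae_of_all _ fun z => ?_) ?_
    · exact hwK.1.mul (contDiff_mollifiedIndicator hδ hD i).continuous.aestronglyMeasurable
    · rw [norm_mul, Real.norm_eq_abs (mollifiedIndicator _ _ _ _),
        abs_of_nonneg (mollifiedIndicator_nonneg hδ hD i z)]
      exact mul_le_of_le_one_right (norm_nonneg _) (mollifiedIndicator_le_one hδ hD i z)
    · filter_upwards [ae_restrict_of_ae (ae_tendsto_mollifiedIndicator hδ hD)] with z hz
      exact hz.const_mul _
  have hlim2 : Tendsto (fun i => ∫ y,
      ⟪((φ i).normed volume ⋆[ContinuousLinearMap.lsmul ℝ ℝ, volume] V₀) y, ν y⟫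
        ∂(μHE[m].restrict (frontier D))) atTop
      (𝓝 (∫ y, ⟪V y, ν y⟫ ∂(μHE[m].restrict (frontier D)))) := by
    refine tendsto_integral_of_dominated_convergence (fun _ => |M|) (fun i => ?_)
      (integrable_const _) (fun i => ?_) ?_
    · refine AEStronglyMeasurable.inner (Continuous.aestronglyMeasurable ?_) hνm
      exact ((φ i).hasCompactSupport_normed.continuous_convolution_left _
        (φ i).continuous_normed hV₀i.locallyIntegrable)
    · filter_upwards [ae_restrict_mem isClosed_frontier.measurableSet] with y hy
      refine (norm_inner_le_norm _ _).trans ?_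
      rw [h.norm_eq y hy, mul_one]
      exact norm_normed_convolution_le _ hM' y
    · filter_upwards [ae_restrict_mem isClosed_frontier.measurableSet] with y hy
      refine Tendsto.inner ?_ tendsto_const_nhds
      have hyD := frontier_subset_closure hy
      have hVy : V₀ =ᶠ[𝓝 y] V := by
        filter_upwards [hKnhds y hyD] with z hz using indicator_of_mem hz V
      refine ContDiffBump.convolution_tendsto_right (tendsto_shrinkingBump_rOut hδ)
        (Eventually.of_forall fun _ => hV₀m) ?_ tendsto_const_nhds
      have hc : Tendsto V₀ (𝓝 y) (𝓝 (V y)) :=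
        (hV.continuousAt (hΩ.mem_nhds (hDΩ hyD))).tendsto.congr' hVy.symm
      exact hc.comp tendsto_snd
  exact tendsto_nhds_unique hlim1 (hlim2.congr fun i => (key i).symm)

end WeakDivergence

/-! ### Weak identities and powers of the norm -/

section Mollification

variable {E : Type*} [NormedAddCommGroup E] [InnerProductSpace ℝ E] [FiniteDimensional ℝ E]
  [MeasurableSpace E] [BorelSpace E]

theorem MeasureTheory.LocallyIntegrableOn.integrable_smul_of_tsupport_subset {F : Type*}
    [NormedAddCommGroup F] [NormedSpace ℝ F] {Ω : Set E} {G : E → F}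
    (hG : LocallyIntegrableOn G Ω) {φ : E → ℝ}
    (hφ : Continuous φ) (hc : HasCompactSupport φ) (hs : tsupport φ ⊆ Ω) :
    Integrable fun z => φ z • G z := by
  have h1 : IntegrableOn (fun z => φ z • G z) (tsupport φ) :=
    (hG.integrableOn_compact_subset hs hc).continuousOn_smul hφ.continuousOn hc
  refine (integrableOn_iff_integrable_of_support_subset fun z hz => ?_).1 h1
  exact subset_tsupport _ fun h0 => hz (by simp [h0])

/-- Mollification commutes with differentiation. -/
theorem fderiv_normed_convolution (φ : ContDiffBump (0 : E)) {g : E → ℝ} (hg : ContDiff ℝ 1 g)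
    (hc : HasCompactSupport g) (z : E) :
    fderiv ℝ (φ.normed volume ⋆[ContinuousLinearMap.lsmul ℝ ℝ, volume] g) z =
      (φ.normed volume ⋆[ContinuousLinearMap.lsmul ℝ ℝ, volume] fderiv ℝ g) z := by
  rw [(hc.hasFDerivAt_convolution_right (ContinuousLinearMap.lsmul ℝ ℝ)
    φ.integrable_normed.locallyIntegrable hg z).fderiv]
  rw [convolution_def, convolution_def]
  congr 1

/-- A weak identity tested against smooth functions may be tested against `C^1` functions. -/
theorem integral_fderiv_eq_of_forall_contDiff {Ω : Set E} (hΩ : IsOpen Ω) {A : E → E} {b : E → ℝ}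
    (hA : ContinuousOn A Ω) (hb : ContinuousOn b Ω)
    (h : ∀ φ : E → ℝ, ContDiff ℝ ∞ φ → HasCompactSupport φ → tsupport φ ⊆ Ω →
      ∫ z, fderiv ℝ φ z (A z) = ∫ z, b z * φ z)
    {φ : E → ℝ} (hφ : ContDiff ℝ 1 φ) (hc : HasCompactSupport φ) (hs : tsupport φ ⊆ Ω) :
    ∫ z, fderiv ℝ φ z (A z) = ∫ z, b z * φ z := by
  obtain ⟨δ, hδ, hδΩ⟩ := IsCompact.exists_cthickening_subset_open hc hΩ hs
  set K := cthickening δ (tsupport φ) with hK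
  have hKc : IsCompact K := IsCompact.cthickening hc
  set ρ : ℕ → ContDiffBump (0 : E) := shrinkingBump E δ hδ
  set ψ : ℕ → E → ℝ := fun i =>
    (ρ i).normed volume ⋆[ContinuousLinearMap.lsmul ℝ ℝ, volume] φ with hψ
  have hφK : tsupport φ ⊆ K := self_subset_cthickening _
  have hψs : ∀ i, tsupport (ψ i) ⊆ K := fun i => by
    refine closure_minimal (fun z hz => ?_) isClosed_cthickening
    by_contra hzK
    refine hz ?_
    simp only [hψ]
    rw [convolution_eq_swap]
    refine integral_eq_zero_of_ae (ae_of_all _ fun t => ?_)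
    by_cases ht : t ∈ tsupport φ
    · have h0 : (ρ i).normed volume (z - t) = 0 := by
        refine normed_sub_eq_zero _ ?_
        by_contra! hlt
        exact hzK (mem_cthickening_of_dist_le z t δ _ ht
          (hlt.le.trans (shrinkingBump_rOut_le hδ i)))
      simp [h0]
    · simp [image_eq_zero_of_notMem_tsupport ht]
  have hψd : ∀ i, ContDiff ℝ ∞ (ψ i) := fun i =>
    (ρ i).hasCompactSupport_normed.contDiff_convolution_left _ (ρ i).contDiff_normed
      hφ.continuous.locallyIntegrable
  have hψeq : ∀ i, ∫ z in K, fderiv ℝ (ψ i) z (A z) = ∫ z in K, b z * ψ i z := fun i => by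
    have h1 := h (ψ i) (hψd i) (hKc.of_isClosed_subset (isClosed_tsupport _) (hψs i))
      ((hψs i).trans hδΩ)
    rw [setIntegral_eq_integral_of_forall_compl_eq_zero,
      setIntegral_eq_integral_of_forall_compl_eq_zero, h1]
    · intro z hz
      rw [image_eq_zero_of_notMem_tsupport fun h' => hz (hψs i h'), mul_zero]
    · intro z hz
      rw [image_eq_zero_of_notMem_tsupport
        fun h' => hz (hψs i (tsupport_fderiv_subset ℝ h'))]
      rfl
  have hDφ := hφ.continuous_fderiv one_ne_zero
  obtain ⟨M, hM⟩ := hφ.continuous.bounded_above_of_compact_support hc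
  obtain ⟨M', hM'⟩ := hDφ.bounded_above_of_compact_support (hc.fderiv ℝ)
  have hAK := hA.mono hδΩ
  have hbK := hb.mono hδΩ
  have hlim1 : Tendsto (fun i => ∫ z in K, fderiv ℝ (ψ i) z (A z)) atTop
      (𝓝 (∫ z in K, fderiv ℝ φ z (A z))) := by
    refine tendsto_integral_of_dominated_convergence (fun z => M' * ‖A z‖) (fun i => ?_)
      ((hAK.integrableOn_compact hKc).norm.const_mul M') (fun i => ae_of_all _ fun z => ?_)
      (ae_of_all _ fun z => ?_)
    · exact ContinuousOn.aestronglyMeasurable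
        ((((hψd i).continuous_fderiv (by simp)).continuousOn).clm_apply hAK) hKc.measurableSet
    · simp only [hψ]
      rw [fderiv_normed_convolution _ hφ hc]
      exact (ContinuousLinearMap.le_opNorm _ _).trans
        (mul_le_mul_of_nonneg_right (norm_normed_convolution_le _ hM' z) (norm_nonneg _))
    · simp only [hψ]
      simp_rw [fderiv_normed_convolution _ hφ hc]
      exact ((ContinuousLinearMap.apply ℝ ℝ (A z)).continuous.tendsto _).comp
        (ContDiffBump.convolution_tendsto_right_of_continuous (tendsto_shrinkingBump_rOut hδ) hDφ z)
  have hlim2 : Tendsto (fun i => ∫ z in K, b z * ψ i z) atTop (𝓝 (∫ z in K, b z * φ z)) := by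
    refine tendsto_integral_of_dominated_convergence (fun z => ‖b z‖ * M) (fun i => ?_)
      ((hbK.integrableOn_compact hKc).norm.mul_const M) (fun i => ae_of_all _ fun z => ?_)
      (ae_of_all _ fun z => ?_)
    · exact (hbK.mul (hψd i).continuous.continuousOn).aestronglyMeasurable hKc.measurableSet
    · rw [norm_mul]
      exact mul_le_mul_of_nonneg_left (norm_normed_convolution_le _ hM z) (norm_nonneg _)
    · exact (ContDiffBump.convolution_tendsto_right_of_continuous
        (tendsto_shrinkingBump_rOut hδ) hφ.continuous z).const_mul _
  have hfin := tendsto_nhds_unique hlim1 (hlim2.congr fun i => (hψeq i).symm)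
  rwa [setIntegral_eq_integral_of_forall_compl_eq_zero,
    setIntegral_eq_integral_of_forall_compl_eq_zero] at hfin
  · intro z hz
    rw [image_eq_zero_of_notMem_tsupport fun h' => hz (hφK h'), mul_zero]
  · intro z hz
    rw [image_eq_zero_of_notMem_tsupport fun h' => hz (hφK (tsupport_fderiv_subset ℝ h'))]
    rfl

omit [MeasurableSpace E] [BorelSpace E] in
/-- For `p < 2` the factor `‖ξ‖ ^ (p - 2)` is singular at `0`, but the product is, up to the factor
`p`, the gradient of the `C^1` function `‖ξ‖ ^ p`. -/
theorem continuous_norm_rpow_smul {p : ℝ} (hp : 1 < p) :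
    Continuous fun ξ : E => ‖ξ‖ ^ (p - 2) • ξ := by
  have h1 : Continuous (gradient fun ξ : E => ‖ξ‖ ^ p) :=
    (InnerProductSpace.toDual ℝ E).symm.continuous.comp
      ((contDiff_norm_rpow hp).continuous_fderiv one_ne_zero)
  have h2 : gradient (fun ξ : E => ‖ξ‖ ^ p) = fun ξ => p • ‖ξ‖ ^ (p - 2) • ξ := by
    ext1 ξ
    rw [gradient, (hasFDerivAt_norm_rpow ξ hp).fderiv]
    refine ext_inner_right ℝ fun v => ?_
    simp [inner_smul_left, mul_assoc]
  rw [h2] at h1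
  have h3 := h1.const_smul p⁻¹
  have hp0 : p ≠ 0 := by linarith
  convert h3 using 2 with ξ
  exact (inv_smul_smul₀ hp0 _).symm

omit [FiniteDimensional ℝ E] [MeasurableSpace E] [BorelSpace E] in
/-- Convexity of `ξ ↦ ‖ξ‖ ^ p / p`, in the form of the gradient inequality. -/
theorem norm_rpow_mul_inner_sub_le {p : ℝ} (hp : 1 < p) (ξ η : E) :
    ‖ξ‖ ^ (p - 2) * ⟪ξ, η - ξ⟫ ≤ ‖η‖ ^ p / p - ‖ξ‖ ^ p / p := by
  -- At `ξ = 0` the left side is `0` whatever the value of `0 ^ (p - 2)`.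
  rcases eq_or_ne ξ 0 with rfl | hξ
  · have : (0 : ℝ) < p := by linarith
    simp only [inner_zero_left, mul_zero, norm_zero, Real.zero_rpow this.ne', zero_div, sub_zero]
    positivity
  have ha : 0 < ‖ξ‖ := norm_pos_iff.2 hξ
  have hpq := Real.HolderConjugate.conjExponent hp
  have h1 := Real.young_inequality_of_nonneg (Real.rpow_nonneg ha.le (p - 1)) (norm_nonneg η)
    hpq.symm
  rw [← Real.rpow_mul ha.le, hpq.sub_one_mul_conj, div_eq_mul_inv _ (Real.conjExponent p),
    eq_sub_of_add_eq' hpq.inv_add_inv_eq_one] at h1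
  have h2 : ‖ξ‖ ^ (p - 2) * ‖ξ‖ = ‖ξ‖ ^ (p - 1) := by
    rw [← Real.rpow_add_one ha.ne']; congr 1; ring
  have h3 : ‖ξ‖ ^ (p - 2) * ‖ξ‖ ^ 2 = ‖ξ‖ ^ p := by
    rw [← Real.rpow_natCast, ← Real.rpow_add ha]; congr 1; push_cast; ring
  have h4 : ⟪ξ, η - ξ⟫ ≤ ‖ξ‖ * ‖η‖ - ‖ξ‖ ^ 2 := by
    rw [inner_sub_right, real_inner_self_eq_norm_sq]
    linarith [real_inner_le_norm ξ η]
  calc _ ≤ ‖ξ‖ ^ (p - 2) * (‖ξ‖ * ‖η‖ - ‖ξ‖ ^ 2) :=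
        mul_le_mul_of_nonneg_left h4 (by positivity)
    _ = ‖ξ‖ ^ (p - 1) * ‖η‖ - ‖ξ‖ ^ p := by rw [mul_sub, ← mul_assoc, h2, h3]
    _ ≤ _ := by rw [div_eq_mul_inv (‖ξ‖ ^ p)]; linarith

end Mollification

/-! ### The Grushin gradient of a `C^1` function and the classical weak formulation -/

namespace Grushin

variable {N l : ℕ}

/-- The orthogonal projection `(v_x, v_y) ↦ (v_x, 0)`. -/
noncomputable def xProj (N l : ℕ) : Space N l →L[ℝ] Space N l :=
  LinearMap.toContinuousLinearMap
    { toFun := fun v => WithLp.toLp 2 (Sum.elim (fun i => v (Sum.inl i)) fun _ => 0)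
      map_add' := fun v w => by ext (i | j) <;> simp
      map_smul' := fun c v => by ext (i | j) <;> simp }

/-- The orthogonal projection `(v_x, v_y) ↦ (0, v_y)`. -/
noncomputable def yProj (N l : ℕ) : Space N l →L[ℝ] Space N l :=
  LinearMap.toContinuousLinearMap
    { toFun := fun v => WithLp.toLp 2 (Sum.elim (fun _ => 0) fun j => v (Sum.inr j))
      map_add' := fun v w => by ext (i | j) <;> simp
      map_smul' := fun c v => by ext (i | j) <;> simp }

@[simp] theorem xProj_inl (v : Space N l) (i : Fin N) : xProj N l v (Sum.inl i) = v (Sum.inl i) :=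
  rfl

@[simp] theorem xProj_inr (v : Space N l) (j : Fin l) : xProj N l v (Sum.inr j) = 0 := rfl

@[simp] theorem yProj_inl (v : Space N l) (i : Fin N) : yProj N l v (Sum.inl i) = 0 := rfl

@[simp] theorem yProj_inr (v : Space N l) (j : Fin l) : yProj N l v (Sum.inr j) = v (Sum.inr j) :=
  rfl

theorem xProj_add_yProj (v : Space N l) : xProj N l v + yProj N l v = v := by
  ext (i | j) <;> simp

theorem inner_eq_add (v w : Space N l) :
    ⟪v, w⟫ = ⟪xPart v, xPart w⟫ + ⟪yPart v, yPart w⟫ := by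
  simp [PiLp.inner_apply, xPart, yPart]

theorem inner_xProj_left (v w : Space N l) : ⟪xProj N l v, w⟫ = ⟪xPart v, xPart w⟫ := by
  simp [PiLp.inner_apply, xPart]

theorem inner_yProj_left (v w : Space N l) : ⟪yProj N l v, w⟫ = ⟪yPart v, yPart w⟫ := by
  simp [PiLp.inner_apply, yPart]

/-- The linear map `(v_x, v_y) ↦ (a v_x, b v_y)`. -/
noncomputable def dil (a b : ℝ) (v : Space N l) : Space N l := a • xProj N l v + b • yProj N l v

theorem scale_eq_dil (γ : ℝ) (z v : Space N l) : scale γ z v = dil 1 (‖xPart z‖ ^ γ) v := by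
  ext (i | j) <;> simp [scale, dil]

theorem dil_dil (a b a' b' : ℝ) (v : Space N l) :
    dil a b (dil a' b' v) = dil (a * a') (b * b') v := by
  ext (i | j) <;> simp [dil, mul_assoc]

theorem smul_dil (c a b : ℝ) (v : Space N l) : c • dil a b v = dil (c * a) (c * b) v := by
  simp [dil, smul_smul]

theorem dil_smul (c a b : ℝ) (v : Space N l) : dil a b (c • v) = c • dil a b v := by
  simp only [dil, map_smul, smul_add, smul_comm c]

theorem dil_sub (a b : ℝ) (v w : Space N l) : dil a b (v - w) = dil a b v - dil a b w := by
  simp only [dil, map_sub, smul_sub]; abel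

theorem dil_one_one (v : Space N l) : dil 1 1 v = v := by
  simp [dil, xProj_add_yProj]

theorem dil_zero (a b : ℝ) : dil a b (0 : Space N l) = 0 := by simp [dil]

theorem inner_dil_left (a b : ℝ) (v w : Space N l) :
    ⟪dil a b v, w⟫ = a * ⟪xPart v, xPart w⟫ + b * ⟪yPart v, yPart w⟫ := by
  rw [dil, inner_add_left, inner_smul_left, inner_smul_left, inner_xProj_left, inner_yProj_left]
  simp

theorem inner_dil_comm (a b : ℝ) (v w : Space N l) : ⟪dil a b v, w⟫ = ⟪v, dil a b w⟫ := by
  rw [real_inner_comm (dil a b w), inner_dil_left, inner_dil_left, real_inner_comm (xPart v),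
    real_inner_comm (yPart v)]

theorem continuous_norm_xPart_rpow {γ : ℝ} (hγ : 0 ≤ γ) :
    Continuous fun z : Space N l => ‖xPart z‖ ^ γ := by
  refine Continuous.rpow_const (Continuous.norm ?_) fun _ => Or.inr hγ
  exact (PiLp.continuous_toLp 2 _).comp (by fun_prop)

theorem continuous_scale {γ : ℝ} (hγ : 0 ≤ γ) :
    Continuous fun q : Space N l × Space N l => scale γ q.1 q.2 := by
  have h1 : Continuous fun q : Space N l × Space N l => ‖xPart q.1‖ ^ γ :=
    (continuous_norm_xPart_rpow hγ).comp continuous_fst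
  have h2 : Continuous fun q : Space N l × Space N l => xProj N l q.2 :=
    (xProj N l).continuous.comp continuous_snd
  have h3 : Continuous fun q : Space N l × Space N l => yProj N l q.2 :=
    (yProj N l).continuous.comp continuous_snd
  simp only [scale_eq_dil, dil]
  exact (h2.const_smul (1 : ℝ)).add (h1.smul h3)

variable {Ω : Set (Space N l)} {γ p : ℝ} {u : Space N l → ℝ}

theorem continuousOn_gradient (hΩ : IsOpen Ω) (hu : ContDiffOn ℝ 1 u Ω) :
    ContinuousOn (gradient u) Ω := fun _ hz =>
  (continuousAt_gradient (hu.contDiffAt (hΩ.mem_nhds hz))).continuousWithinAt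

theorem continuousOn_grad (hγ : 0 ≤ γ) (hΩ : IsOpen Ω) (hu : ContDiffOn ℝ 1 u Ω) :
    ContinuousOn (grad γ u) Ω :=
  (continuous_scale hγ).comp_continuousOn (continuousOn_id.prodMk (continuousOn_gradient hΩ hu))

/-- The coefficient of the `k`-th partial derivative in the Grushin gradient. -/
noncomputable def coeff (γ : ℝ) (k : Fin N ⊕ Fin l) (z : Space N l) : ℝ :=
  k.elim (fun _ => 1) fun _ => ‖xPart z‖ ^ γ

theorem grad_apply (γ : ℝ) (u : Space N l → ℝ) (z : Space N l) (k : Fin N ⊕ Fin l) :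
    grad γ u z k = coeff γ k z * fderiv ℝ u z (EuclideanSpace.single k 1) := by
  rw [← inner_gradient, EuclideanSpace.inner_single_right]
  rcases k with i | j <;> simp [grad, scale, coeff]

theorem continuous_coeff (hγ : 0 ≤ γ) (k : Fin N ⊕ Fin l) :
    Continuous (coeff γ k : Space N l → ℝ) := by
  rcases k with i | j
  exacts [continuous_const, continuous_norm_xPart_rpow hγ]

/-- The field `c_k ∂_k` is formally skew-adjoint because its coefficient `c_k` does not depend on
the `k`-th variable. -/
theorem coeff_add_smul_single (k : Fin N ⊕ Fin l) (z : Space N l) (t : ℝ) :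
    coeff γ k (z + t • EuclideanSpace.single k 1) = coeff γ k z := by
  rcases k with i | j
  · simp only [coeff, Sum.elim_inl]
  · have : xPart (z + t • EuclideanSpace.single (Sum.inr j) 1) = xPart z := by
      ext i
      simp [xPart]
    simp [coeff, this]

/-- Integration by parts: the classical Grushin gradient of a `C^1` function is its weak one. -/
theorem isWeakGrad_grad (hγ : 0 ≤ γ) (hΩ : IsOpen Ω) (hu : ContDiffOn ℝ 1 u Ω) :
    IsWeakGrad Ω γ u (grad γ u) := by
  have hlu : LocallyIntegrableOn u Ω := hu.continuousOn.locallyIntegrableOn hΩ.measurableSet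
  have hlg : LocallyIntegrableOn (grad γ u) Ω :=
    (continuousOn_grad hγ hΩ hu).locallyIntegrableOn hΩ.measurableSet
  refine ⟨hlu, hlg, fun φ hφ => ?_⟩
  have hφ1 : ContDiff ℝ 1 φ := hφ.contDiff.of_le (by norm_num)
  have hDφ := hφ1.continuous_fderiv one_ne_zero
  have hgφ : Continuous (grad γ φ) :=
    continuousOn_univ.1 (continuousOn_grad hγ isOpen_univ hφ1.contDiffOn)
  have hout : ∀ z ∉ tsupport φ, fderiv ℝ φ z = 0 := fun z hz =>
    image_eq_zero_of_notMem_tsupport fun h => hz (tsupport_fderiv_subset ℝ h)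
  have hgφ0 : ∀ z ∉ tsupport φ, grad γ φ z = 0 := fun z hz => by
    ext k; rw [grad_apply, hout z hz]; simp
  have hφ0 : ∀ z ∉ Ω, φ z = 0 := fun z hz =>
    image_eq_zero_of_notMem_tsupport fun h => hz (hφ.tsupport_subset h)
  rw [setIntegral_eq_integral_of_forall_compl_eq_zero
      (fun z hz => by rw [hgφ0 z fun h => hz (hφ.tsupport_subset h), smul_zero]),
    setIntegral_eq_integral_of_forall_compl_eq_zero
      (fun z hz => by rw [hφ0 z hz, zero_smul])]
  have hi2 : Integrable fun z => φ z • grad γ u z :=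
    hlg.integrable_smul_of_tsupport_subset hφ1.continuous hφ.hasCompactSupport hφ.tsupport_subset
  have hi1 : Integrable fun z => u z • grad γ φ z := by
    have h1 : IntegrableOn (fun z => u z • grad γ φ z) (tsupport φ) :=
      (hlu.integrableOn_compact_subset hφ.tsupport_subset hφ.hasCompactSupport).smul_continuousOn
        hgφ.continuousOn hφ.hasCompactSupport
    refine (integrableOn_iff_integrable_of_support_subset fun z hz => ?_).1 h1
    by_contra h
    exact hz (by simp [hgφ0 z h])
  ext k
  have hc1 := (EuclideanSpace.proj k : Space N l →L[ℝ] ℝ).integral_comp_comm hi1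
  have hc2 := (EuclideanSpace.proj k : Space N l →L[ℝ] ℝ).integral_comp_comm hi2
  have hj1 := (EuclideanSpace.proj k : Space N l →L[ℝ] ℝ).integrable_comp hi1
  have hj2 := (EuclideanSpace.proj k : Space N l →L[ℝ] ℝ).integrable_comp hi2
  simp only [PiLp.proj_apply, PiLp.smul_apply, smul_eq_mul, PiLp.neg_apply, grad_apply]
    at hc1 hc2 hj1 hj2 ⊢
  rw [← hc1, ← hc2]
  have hi3 : Integrable fun z => u z * (coeff γ k z * φ z) := by
    have := hlu.integrable_smul_of_tsupport_subset (φ := fun z => coeff γ k z * φ z)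
      ((continuous_coeff hγ k).mul hφ1.continuous) hφ.hasCompactSupport.mul_left
      ((closure_mono (Function.support_mul_subset_right _ _)).trans hφ.tsupport_subset)
    refine this.congr (ae_of_all _ fun z => ?_)
    simp [mul_comm]
  have hibp := integral_bilinear_hasLineDerivAt_right_eq_neg_left_of_integrable
    (μ := (volume : Measure (Space N l))) (B := ContinuousLinearMap.mul ℝ ℝ)
    (v := EuclideanSpace.single k 1) (f := u) (g := fun z => coeff γ k z * φ z)
    (f' := fun z => fderiv ℝ u z (EuclideanSpace.single k 1))
    (g' := fun z => coeff γ k z * fderiv ℝ φ z (EuclideanSpace.single k 1))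
    (hj2.congr (ae_of_all _ fun z => by simp; ring)) hj1 hi3
    (fun z hz => by
      have hzΩ := hφ.tsupport_subset (closure_mono (Function.support_mul_subset_right _ _) hz)
      exact ((hu.contDiffAt (hΩ.mem_nhds hzΩ)).differentiableAt
        one_ne_zero).hasFDerivAt.hasLineDerivAt _)
    (fun z _ => by
      have h1 : HasLineDerivAt ℝ φ (fderiv ℝ φ z (EuclideanSpace.single k 1)) z
          (EuclideanSpace.single k 1) :=
        ((hφ1.differentiable one_ne_zero).differentiableAt.hasFDerivAt).hasLineDerivAt _
      have h2 := HasDerivAt.const_mul (coeff γ k z) h1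
      simpa only [HasLineDerivAt, coeff_add_smul_single] using h2)
  simp only [ContinuousLinearMap.mul_apply'] at hibp
  rw [hibp]
  congr 1
  refine integral_congr_ae (ae_of_all _ fun z => ?_)
  simp only
  ring

theorem IsWeakGrad.ae_eq {G₁ G₂ : Space N l → Space N l} (hΩ : IsOpen Ω)
    (h₁ : IsWeakGrad Ω γ u G₁) (h₂ : IsWeakGrad Ω γ u G₂) :
    G₁ =ᵐ[volume.restrict Ω] G₂ := by
  have key := hΩ.ae_eq_zero_of_integral_contDiff_smul_eq_zero (μ := volume)
    (f := fun z => G₁ z - G₂ z) (h₁.locallyIntegrableOn_grad.sub h₂.locallyIntegrableOn_grad)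
    fun φ hφ hc hs => by
      have hi1 := h₁.locallyIntegrableOn_grad.integrable_smul_of_tsupport_subset
        hφ.continuous hc hs
      have hi2 := h₂.locallyIntegrableOn_grad.integrable_smul_of_tsupport_subset
        hφ.continuous hc hs
      have h3 : ∀ z ∉ Ω, φ z = 0 := fun z hz =>
        image_eq_zero_of_notMem_tsupport fun h => hz (hs h)
      have e1 := h₁.integral_eq φ ⟨hφ, hc, hs⟩
      have e2 := h₂.integral_eq φ ⟨hφ, hc, hs⟩
      rw [e1, neg_inj, setIntegral_eq_integral_of_forall_compl_eq_zero
          (fun z hz => by rw [h3 z hz, zero_smul]),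
        setIntegral_eq_integral_of_forall_compl_eq_zero
          (fun z hz => by rw [h3 z hz, zero_smul])] at e2
      simp only [smul_sub]
      rw [integral_sub hi1 hi2, e2, sub_self]
  refine (ae_restrict_iff' hΩ.measurableSet).2 (key.mono fun z hz hzΩ => ?_)
  exact sub_eq_zero.1 (hz hzΩ)

theorem weakGrad_ae_eq (hγ : 0 ≤ γ) (hΩ : IsOpen Ω) (hu : ContDiffOn ℝ 1 u Ω) :
    weakGrad Ω γ u =ᵐ[volume.restrict Ω] grad γ u := by
  have hex : ∃ G, IsWeakGrad Ω γ u G := ⟨_, isWeakGrad_grad hγ hΩ hu⟩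
  rw [weakGrad, dif_pos hex]
  exact hex.choose_spec.ae_eq hΩ (isWeakGrad_grad hγ hΩ hu)

theorem gradient_eq_zero_of_notMem_tsupport {φ : Space N l → ℝ} {z : Space N l}
    (hz : z ∉ tsupport φ) : gradient φ z = 0 := by
  have : fderiv ℝ φ z = 0 :=
    image_eq_zero_of_notMem_tsupport fun h => hz (tsupport_fderiv_subset ℝ h)
  rw [gradient, this, map_zero]

theorem IsTest.mem_sobolevZero (hγ : 0 ≤ γ) (hp : 0 < p) (hΩ : IsOpen Ω) {φ : Space N l → ℝ}
    (hφ : IsTest Ω φ) : φ ∈ SobolevZero Ω γ p := by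
  have hφ1 : ContDiff ℝ 1 φ := hφ.contDiff.of_le (by norm_num)
  have hgφ : Continuous (grad γ φ) :=
    continuousOn_univ.1 (continuousOn_grad hγ isOpen_univ hφ1.contDiffOn)
  have hgc : HasCompactSupport (grad γ φ) :=
    HasCompactSupport.intro hφ.hasCompactSupport fun z hz => by
      rw [grad, gradient_eq_zero_of_notMem_tsupport hz, scale_eq_dil, dil_zero]
  refine ⟨⟨?_, ⟨_, isWeakGrad_grad hγ hΩ hφ1.contDiffOn⟩, ?_⟩, fun ε hε => ⟨φ, hφ, ?_⟩⟩
  · exact (hφ1.continuous.memLp_of_hasCompactSupport hφ.hasCompactSupport).restrict _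
  · exact ((hgφ.memLp_of_hasCompactSupport hgc).restrict _).ae_eq
      (weakGrad_ae_eq hγ hΩ hφ1.contDiffOn).symm
  · have h0 : weakGrad Ω γ (φ - φ) =ᵐ[volume.restrict Ω] fun _ => 0 := by
      rw [sub_self]
      refine (weakGrad_ae_eq (u := 0) hγ hΩ contDiff_zero_fun.contDiffOn).trans
        (ae_of_all _ fun z => ?_)
      rw [grad, gradient_eq_zero_of_notMem_tsupport (by simp [tsupport]), scale_eq_dil, dil_zero]
    have h1 : ∫ z in Ω, (‖weakGrad Ω γ (φ - φ) z‖ ^ p + |(φ - φ) z| ^ p) = 0 := by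
      rw [integral_congr_ae (g := fun _ => (0 : ℝ)) ?_, integral_zero]
      filter_upwards [h0] with z hz
      rw [hz]
      simp [hp.ne']
    rw [sobolevNorm, h1, Real.zero_rpow (by positivity)]
    exact hε

/-- The flux field of the Grushin `p`-Laplacian: `⟪flux, ∇φ⟫ = |∇_γ u|^{p-2} ⟪∇_γ u, ∇_γ φ⟫`. -/
noncomputable def flux (γ p : ℝ) (u : Space N l → ℝ) (z : Space N l) : Space N l :=
  scale γ z (‖grad γ u z‖ ^ (p - 2) • grad γ u z)

theorem inner_flux_left (γ p : ℝ) (u : Space N l → ℝ) (z v : Space N l) :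
    ⟪flux γ p u z, v⟫ = ‖grad γ u z‖ ^ (p - 2) * ⟪grad γ u z, scale γ z v⟫ := by
  rw [flux, scale_eq_dil, inner_dil_comm, ← scale_eq_dil, inner_smul_left]
  simp

theorem continuousOn_flux (hγ : 0 ≤ γ) (hp : 1 < p) (hΩ : IsOpen Ω) (hu : ContDiffOn ℝ 1 u Ω) :
    ContinuousOn (flux γ p u) Ω :=
  (continuous_scale hγ).comp_continuousOn (continuousOn_id.prodMk
    ((continuous_norm_rpow_smul hp).comp_continuousOn (continuousOn_grad hγ hΩ hu)))

/-- For a `C^1` solution the weak formulation holds classically, with `C^1` test functions of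
compact support in `Ω`. -/
theorem IsWeakSolution.integral_fderiv_flux_eq {f : Space N l → ℝ → ℝ} (hγ : 0 ≤ γ) (hp : 1 < p)
    (hΩ : IsOpen Ω) (hf : Continuous (Function.uncurry f)) (hu : IsWeakSolution Ω γ p f u)
    (huC1 : ContDiffOn ℝ 1 u Ω) {φ : Space N l → ℝ} (hφ : ContDiff ℝ 1 φ)
    (hc : HasCompactSupport φ) (hs : tsupport φ ⊆ Ω) :
    ∫ z, fderiv ℝ φ z (flux γ p u z) = ∫ z, f z (u z) * φ z := by
  refine integral_fderiv_eq_of_forall_contDiff (b := fun z => f z (u z)) hΩ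
    (continuousOn_flux hγ hp hΩ huC1)
    (hf.comp_continuousOn (continuousOn_id.prodMk huC1.continuousOn)) (fun ψ hψ hψc hψs => ?_)
    hφ hc hs
  have h1 := hu.integral_eq ψ (IsTest.mem_sobolevZero hγ (by linarith) hΩ ⟨hψ, hψc, hψs⟩)
  have hψ0 : ∀ z ∉ Ω, ψ z = 0 := fun z hz =>
    image_eq_zero_of_notMem_tsupport fun h => hz (hψs h)
  rw [setIntegral_eq_integral_of_forall_compl_eq_zero (f := fun z => f z (u z) * ψ z)
    (fun z hz => by rw [hψ0 z hz, mul_zero])] at h1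
  rw [← h1, ← setIntegral_eq_integral_of_forall_compl_eq_zero (s := Ω)]
  · refine integral_congr_ae ?_
    filter_upwards [weakGrad_ae_eq hγ hΩ huC1,
      weakGrad_ae_eq hγ hΩ (hψ.of_le (by norm_num) : ContDiff ℝ 1 ψ).contDiffOn] with z hz hz'
    rw [hz, hz', ← inner_gradient, real_inner_comm, inner_flux_left]
    rfl
  · intro z hz
    rw [← inner_gradient, gradient_eq_zero_of_notMem_tsupport fun h => hz (hψs h), inner_zero_left]

end Grushin

/-! ### Products with compactly supported functions -/

section Calculus

variable {E : Type*} [NormedAddCommGroup E] [NormedSpace ℝ E]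

theorem contDiff_mul_of_tsupport_subset {U : Set E} (hU : IsOpen U) {η v : E → ℝ}
    (hη : ContDiff ℝ 1 η) (hs : tsupport η ⊆ U) (hv : ContDiffOn ℝ 1 v U) :
    ContDiff ℝ 1 fun z => η z * v z := by
  refine contDiff_iff_contDiffAt.2 fun z => ?_
  by_cases hz : z ∈ tsupport η
  · exact hη.contDiffAt.mul (hv.contDiffAt (hU.mem_nhds (hs hz)))
  · refine contDiffAt_const (c := (0 : ℝ)) |>.congr_of_eventuallyEq ?_
    filter_upwards [(isClosed_tsupport η).isOpen_compl.mem_nhds hz] with w hw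
    rw [image_eq_zero_of_notMem_tsupport hw, zero_mul]

omit [NormedSpace ℝ E] in
theorem tsupport_mul_subset_left' {η v : E → ℝ} : tsupport (fun z => η z * v z) ⊆ tsupport η :=
  closure_mono (Function.support_mul_subset_left _ _)

theorem fderiv_eq_zero_of_notMem_tsupport {η : E → ℝ} {z : E} (hz : z ∉ tsupport η) :
    fderiv ℝ η z = 0 :=
  image_eq_zero_of_notMem_tsupport fun h => hz (tsupport_fderiv_subset ℝ h)

theorem fderiv_mul_apply_of_mem {U : Set E} (hU : IsOpen U) {η v : E → ℝ}
    (hη : ContDiff ℝ 1 η) (hv : ContDiffOn ℝ 1 v U) {z : E} (hz : z ∈ U) (a : E) :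
    fderiv ℝ (fun z => η z * v z) z a = η z * fderiv ℝ v z a + v z * fderiv ℝ η z a := by
  rw [fderiv_fun_mul ((hη.differentiable one_ne_zero).differentiableAt)
    ((hv.contDiffAt (hU.mem_nhds hz)).differentiableAt one_ne_zero)]
  simp

omit [NormedSpace ℝ E] in
/-- Differentiation under the integral sign over a compact set. -/
theorem hasDerivAt_setIntegral_of_continuousOn [MeasurableSpace E] [BorelSpace E] {μ : Measure E}
    [IsFiniteMeasureOnCompacts μ] {K : Set E} (hK : IsCompact K) {δ : ℝ} (hδ : 0 < δ)
    {F F' : ℝ → E → ℝ}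
    (hF : ContinuousOn (fun q : ℝ × E => F q.1 q.2) (closedBall 0 δ ×ˢ K))
    (hF' : ContinuousOn (fun q : ℝ × E => F' q.1 q.2) (closedBall 0 δ ×ˢ K))
    (hderiv : ∀ t ∈ closedBall (0 : ℝ) δ, ∀ z ∈ K, HasDerivAt (fun s => F s z) (F' t z) t) :
    HasDerivAt (fun t => ∫ z in K, F t z ∂μ) (∫ z in K, F' 0 z ∂μ) 0 := by
  have h0 : (0 : ℝ) ∈ closedBall (0 : ℝ) δ := mem_closedBall_self hδ.le
  have hslice : ∀ {H : ℝ → E → ℝ}, ContinuousOn (fun q : ℝ × E => H q.1 q.2)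
      (closedBall 0 δ ×ˢ K) → ∀ t ∈ closedBall (0 : ℝ) δ, ContinuousOn (H t) K :=
    fun {H} hH t ht => hH.comp (f := fun z : E => (t, z)) (by fun_prop) fun z hz => ⟨ht, hz⟩
  obtain ⟨C, hC⟩ := ((isCompact_closedBall (0 : ℝ) δ).prod hK).exists_bound_of_continuousOn hF'
  refine (hasDerivAt_integral_of_dominated_loc_of_deriv_le (F' := F')
    (bound := fun _ => C) (closedBall_mem_nhds (0 : ℝ) hδ) ?_ ?_ ?_ ?_ ?_ ?_).2
  · filter_upwards [closedBall_mem_nhds (0 : ℝ) hδ] with t ht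
    exact (hslice hF t ht).aestronglyMeasurable_of_isCompact hK hK.measurableSet
  · exact (hslice hF 0 h0).integrableOn_compact hK
  · exact (hslice hF' 0 h0).aestronglyMeasurable_of_isCompact hK hK.measurableSet
  · filter_upwards [ae_restrict_mem hK.measurableSet] with z hz t ht using hC (t, z) ⟨ht, hz⟩
  · exact integrableOn_const hK.measure_lt_top.ne
  · filter_upwards [ae_restrict_mem hK.measurableSet] with z hz t ht using hderiv t ht z hz

/-- This includes `a = 0` with `p < 2`, where `0 ^ (p - 2) = 0`, and `p = 2`, where
`0 ^ 0 * 0 ^ 2 = 0`. -/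
theorem rpow_sub_two_mul_sq {a p : ℝ} (ha : 0 ≤ a) (hp : 0 < p) : a ^ (p - 2) * a ^ 2 = a ^ p := by
  rcases ha.eq_or_lt with rfl | ha
  · simp [hp.ne']
  · rw [← Real.rpow_natCast, ← Real.rpow_add ha]
    congr 1
    push_cast
    ring

end Calculus

/-! ### Distributional divergences of two first-order fields -/

namespace Grushin

variable {N l : ℕ} {Ω : Set (Space N l)} {γ p : ℝ} {f : Space N l → ℝ → ℝ} {u : Space N l → ℝ}
  {η : Space N l → ℝ}

theorem fderiv_apply_flux (hp : 0 < p) (z : Space N l) :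
    fderiv ℝ u z (flux γ p u z) = ‖grad γ u z‖ ^ p := by
  rw [← inner_gradient, real_inner_comm, inner_flux_left]
  change _ * ⟪grad γ u z, grad γ u z⟫ = _
  rw [real_inner_self_eq_norm_sq, rpow_sub_two_mul_sq (norm_nonneg _) hp]

theorem continuousOn_norm_grad_rpow (hγ : 0 ≤ γ) (hp : 0 < p) (hΩ : IsOpen Ω)
    (hu : ContDiffOn ℝ 1 u Ω) : ContinuousOn (fun z => ‖grad γ u z‖ ^ p) Ω :=
  (continuousOn_grad hγ hΩ hu).norm.rpow_const fun _ _ => Or.inr hp.le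

/-- The field `u |∇_γ u|^{p-2} ∇_γ u` has divergence `|∇_γ u|^p - f(z, u) u`. -/
theorem IsWeakSolution.weak_divergence_smul_flux (hγ : 0 ≤ γ) (hp : 1 < p) (hΩ : IsOpen Ω)
    (hf : Continuous (Function.uncurry f)) (hu : IsWeakSolution Ω γ p f u)
    (huC1 : ContDiffOn ℝ 1 u Ω) (hη : ContDiff ℝ 1 η) (hc : HasCompactSupport η)
    (hs : tsupport η ⊆ Ω) :
    ∫ z, fderiv ℝ η z (u z • flux γ p u z) =
      -∫ z, (‖grad γ u z‖ ^ p - f z (u z) * u z) * η z := by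
  have hp0 : 0 < p := by linarith
  set K := tsupport η with hK
  have hKc : IsCompact K := hc
  have hfu : ContinuousOn (fun z => f z (u z)) Ω :=
    hf.comp_continuousOn (continuousOn_id.prodMk huC1.continuousOn)
  have hA := continuousOn_flux hγ hp hΩ huC1
  have hG := continuousOn_norm_grad_rpow hγ hp0 hΩ huC1
  have hDη := hη.continuous_fderiv one_ne_zero
  have h1 := hu.integral_fderiv_flux_eq hγ hp hΩ hf huC1
    (contDiff_mul_of_tsupport_subset hΩ hη hs huC1) hc.mul_right
    (tsupport_mul_subset_left'.trans hs)
  have hη0 : ∀ z ∉ K, η z = 0 := fun z hz => image_eq_zero_of_notMem_tsupport hz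
  rw [← setIntegral_eq_integral_of_forall_compl_eq_zero (s := K) (fun z hz => by
      rw [fderiv_eq_zero_of_notMem_tsupport fun h => hz (tsupport_mul_subset_left' h)]; rfl),
    ← setIntegral_eq_integral_of_forall_compl_eq_zero (s := K) (f := fun z => f z (u z) * _)
      (fun z hz => by rw [hη0 z hz, zero_mul, mul_zero])] at h1
  rw [← setIntegral_eq_integral_of_forall_compl_eq_zero (s := K) (fun z hz => by
      rw [fderiv_eq_zero_of_notMem_tsupport hz]; rfl),
    ← setIntegral_eq_integral_of_forall_compl_eq_zero (s := K) (f := fun z => _ * η z)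
      (fun z hz => by rw [hη0 z hz, mul_zero])]
  have h2 : ∫ z in K, fderiv ℝ (fun z => η z * u z) z (flux γ p u z) =
      ∫ z in K, (η z * ‖grad γ u z‖ ^ p + fderiv ℝ η z (u z • flux γ p u z)) := by
    refine setIntegral_congr_fun hKc.measurableSet fun z hz => ?_
    rw [fderiv_mul_apply_of_mem hΩ hη huC1 (hs hz), fderiv_apply_flux hp0, map_smul, smul_eq_mul]
  rw [h2, integral_add] at h1
  · rw [← integral_neg, eq_sub_of_add_eq' h1, ← integral_sub]
    · refine integral_congr_ae (ae_of_all _ fun z => ?_)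
      simp only
      ring
    · exact ((hfu.mono hs).mul (hη.continuous.continuousOn.mul
        (huC1.continuousOn.mono hs))).integrableOn_compact hKc
    · exact (hη.continuous.continuousOn.mul (hG.mono hs)).integrableOn_compact hKc
  · exact (hη.continuous.continuousOn.mul (hG.mono hs)).integrableOn_compact hKc
  · exact (hDη.continuousOn.clm_apply
      ((huC1.continuousOn.smul hA).mono hs)).integrableOn_compact hKc

theorem apply_eq_sum_single (L : Space N l →L[ℝ] ℝ) (z : Space N l) :
    L z = ∑ k, z k * L (EuclideanSpace.single k 1) := by
  have h := (EuclideanSpace.basisFun (Fin N ⊕ Fin l) ℝ).sum_repr z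
  conv_lhs => rw [← h]
  rw [map_sum]
  simp

/-- The field `Φ(z) z` has divergence `(N + l) Φ + ⟪∇Φ, z⟫`; here `Φ` is only assumed
differentiable, with locally integrable gradient. -/
theorem weak_divergence_smul_id {Φ : Space N l → ℝ} {H : Space N l → Space N l}
    (hΦ : ∀ z ∈ Ω, HasGradientAt Φ (H z) z) (hH : LocallyIntegrableOn H Ω)
    (hη : ContDiff ℝ 1 η) (hc : HasCompactSupport η) (hs : tsupport η ⊆ Ω) :
    ∫ z, fderiv ℝ η z (Φ z • z) = -∫ z, (((N + l : ℕ) : ℝ) * Φ z + ⟪H z, z⟫) * η z := by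
  have hΦc : ContinuousOn Φ Ω := fun z hz => (hΦ z hz).continuousAt.continuousWithinAt
  set K := tsupport η with hK
  have hKc : IsCompact K := hc
  have hDη := hη.continuous_fderiv one_ne_zero
  have hint : ∀ F : Space N l → ℝ, ContinuousOn F K → (∀ z ∉ K, F z = 0) → Integrable F :=
    fun F hF h0 => (integrableOn_iff_integrable_of_support_subset fun z hz => by
      by_contra h; exact hz (h0 z h)).1 (hF.integrableOn_compact hKc)
  have hη0 : ∀ z ∉ K, η z = 0 := fun z hz => image_eq_zero_of_notMem_tsupport hz
  have hDη0 : ∀ z ∉ K, fderiv ℝ η z = 0 := fun z hz => fderiv_eq_zero_of_notMem_tsupport hz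
  have hcoord : ∀ k : Fin N ⊕ Fin l, Continuous fun z : Space N l => z k := fun k => by fun_prop
  let e : Fin N ⊕ Fin l → Space N l := fun k => EuclideanSpace.single k 1
  have hI1 : Integrable fun z => Φ z * η z :=
    hint _ ((hΦc.mono hs).mul hη.continuous.continuousOn) fun z hz => by rw [hη0 z hz, mul_zero]
  have hI2 : ∀ k, Integrable fun z => Φ z * (z k * fderiv ℝ η z (e k)) := fun k =>
    hint _ ((hΦc.mono hs).mul ((hcoord k).mul (hDη.clm_apply continuous_const)).continuousOn)
      fun z hz => by rw [hDη0 z hz]; simp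
  have hI3 : ∀ k, Integrable fun z => H z k * (z k * η z) := fun k => by
    have h1 := hH.integrable_smul_of_tsupport_subset (φ := fun z => η z * z k)
      (hη.continuous.mul (hcoord k)) hc.mul_right (tsupport_mul_subset_left'.trans hs)
    have h2 := (EuclideanSpace.proj k : Space N l →L[ℝ] ℝ).integrable_comp h1
    refine h2.congr (ae_of_all _ fun z => ?_)
    simp only [PiLp.proj_apply, PiLp.smul_apply, smul_eq_mul]
    ring
  have hibp : ∀ k, ∫ z, Φ z * (z k * fderiv ℝ η z (e k)) =
      -(∫ z, Φ z * η z) - ∫ z, H z k * (z k * η z) := fun k => by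
    have h := integral_bilinear_hasLineDerivAt_right_eq_neg_left_of_integrable
      (μ := (volume : Measure (Space N l))) (B := ContinuousLinearMap.mul ℝ ℝ)
      (v := e k) (f := Φ) (g := fun z => z k * η z) (f' := fun z => H z k)
      (g' := fun z => η z + z k * fderiv ℝ η z (e k)) (hI3 k)
      ((hI1.add (hI2 k)).congr (ae_of_all _ fun z => by simp; ring))
      (hint _ ((hΦc.mono hs).mul ((hcoord k).mul hη.continuous).continuousOn)
        fun z hz => by rw [hη0 z hz]; simp)
      (fun z hz => by
        have hzK : z ∈ K := closure_mono (Function.support_mul_subset_right _ _) hz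
        have h1 := (hΦ z (hs hzK)).hasFDerivAt.hasLineDerivAt (e k)
        rwa [InnerProductSpace.toDual_apply_apply, EuclideanSpace.inner_single_right,
          one_mul] at h1)
      (fun z _ => by
        have h1 : HasDerivAt (fun t : ℝ => (z + t • e k) k) 1 0 := by
          simpa [e] using (hasDerivAt_id (0 : ℝ)).const_add (z k)
        have h2 : HasDerivAt (fun t : ℝ => η (z + t • e k)) (fderiv ℝ η z (e k)) 0 :=
          ((hη.differentiable one_ne_zero).differentiableAt.hasFDerivAt).hasLineDerivAt (e k)
        exact (h1.mul h2).congr_deriv (by simp))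
    simp only [ContinuousLinearMap.mul_apply', mul_add] at h
    rw [integral_add hI1 (hI2 k)] at h
    linarith
  have hL : ∫ z, fderiv ℝ η z (Φ z • z) = ∑ k, ∫ z, Φ z * (z k * fderiv ℝ η z (e k)) := by
    rw [← integral_finsetSum _ fun k _ => hI2 k]
    refine integral_congr_ae (ae_of_all _ fun z => ?_)
    simp only
    rw [map_smul, apply_eq_sum_single, smul_eq_mul, Finset.mul_sum]
  have hR : ∫ z, (((N + l : ℕ) : ℝ) * Φ z + ⟪H z, z⟫) * η z =
      ∑ k : Fin N ⊕ Fin l, ((∫ z, Φ z * η z) + ∫ z, H z k * (z k * η z)) := by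
    rw [Finset.sum_congr rfl fun k _ => (integral_add hI1 (hI3 k)).symm,
      ← integral_finsetSum _ fun k _ =>
        (hI1.add (hI3 k) : Integrable fun z => Φ z * η z + H z k * (z k * η z))]
    refine integral_congr_ae (ae_of_all _ fun z => ?_)
    simp only
    rw [Finset.sum_add_distrib, Finset.sum_const, Finset.card_univ, Fintype.card_sum,
      Fintype.card_fin, Fintype.card_fin, nsmul_eq_mul, add_mul, PiLp.inner_apply, Finset.sum_mul,
      mul_assoc]
    congr 1
    refine Finset.sum_congr rfl fun k _ => ?_
    simp
    ring
  rw [hL, hR, ← Finset.sum_neg_distrib]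
  refine Finset.sum_congr rfl fun k _ => ?_
  rw [hibp k]
  ring

/-! ### Behaviour under dilations -/

/-- The Grushin gradient of `z ↦ u (e^t z)` at the point `z`, as a function of `w = e^t z`. -/
noncomputable def dilGrad (γ : ℝ) (u : Space N l → ℝ) (t : ℝ) (w : Space N l) : Space N l :=
  dil (Real.exp t) (Real.exp ((1 - γ) * t)) (grad γ u w)

theorem norm_xPart_smul_rpow (γ t : ℝ) (z : Space N l) :
    ‖xPart (Real.exp t • z)‖ ^ γ = Real.exp (t * γ) * ‖xPart z‖ ^ γ := by
  have : xPart (Real.exp t • z) = Real.exp t • xPart z := by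
    ext i
    simp [xPart]
  rw [this, norm_smul, Real.norm_eq_abs, Real.abs_exp, Real.mul_rpow (Real.exp_pos t).le
    (norm_nonneg _), Real.exp_mul]

/-- The weight `|x|^γ` is homogeneous, so dilations act on the Grushin gradient by a constant
linear map. -/
theorem scale_exp_smul_gradient (γ t : ℝ) (u : Space N l → ℝ) (z : Space N l) :
    scale γ z (Real.exp t • gradient u (Real.exp t • z)) = dilGrad γ u t (Real.exp t • z) := by
  rw [dilGrad, grad, scale_eq_dil, scale_eq_dil, dil_dil, norm_xPart_smul_rpow, dil_smul, smul_dil,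
    mul_one, ← mul_assoc, ← Real.exp_add]
  congr 3
  ring

theorem dilGrad_zero (γ : ℝ) (u : Space N l → ℝ) (w : Space N l) :
    dilGrad γ u 0 w = grad γ u w := by
  simp [dilGrad, dil_one_one]

theorem hasDerivAt_dil_exp (γ t : ℝ) (v : Space N l) :
    HasDerivAt (fun s => dil (Real.exp s) (Real.exp ((1 - γ) * s)) v)
      (dil (Real.exp t) ((1 - γ) * Real.exp ((1 - γ) * t)) v) t := by
  have h1 : HasDerivAt (fun s : ℝ => Real.exp ((1 - γ) * s))
      ((1 - γ) * Real.exp ((1 - γ) * t)) t := by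
    have := ((hasDerivAt_id t).const_mul (1 - γ)).exp
    simpa [mul_comm] using this
  exact ((Real.hasDerivAt_exp t).smul_const _).add (h1.smul_const _)

theorem hasDerivAt_norm_dilGrad_rpow (hp : 1 < p) (t : ℝ) (w : Space N l) :
    HasDerivAt (fun s => ‖dilGrad γ u s w‖ ^ p / p)
      (‖dilGrad γ u t w‖ ^ (p - 2) * ⟪dilGrad γ u t w,
        dil (Real.exp t) ((1 - γ) * Real.exp ((1 - γ) * t)) (grad γ u w)⟫) t := by
  have h := ((hasFDerivAt_norm_rpow (dilGrad γ u t w) hp).comp_hasDerivAt t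
    (hasDerivAt_dil_exp γ t (grad γ u w))).div_const p
  refine h.congr_deriv ?_
  have hp0 : p ≠ 0 := by linarith
  simp only [smul_apply, innerSL_apply_apply, smul_eq_mul]
  field_simp

theorem continuousOn_dil_exp (hγ : 0 ≤ γ) (hΩ : IsOpen Ω) (hu : ContDiffOn ℝ 1 u Ω) (c : ℝ) :
    ContinuousOn (fun q : ℝ × Space N l =>
      dil (Real.exp q.1) (c * Real.exp ((1 - γ) * q.1)) (grad γ u q.2)) (univ ×ˢ Ω) := by
  have hG : ContinuousOn (fun q : ℝ × Space N l => grad γ u q.2) (univ ×ˢ Ω) :=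
    (continuousOn_grad hγ hΩ hu).comp continuousOn_snd fun q hq => hq.2
  have h1 : ContinuousOn (fun q : ℝ × Space N l => Real.exp q.1) (univ ×ˢ Ω) := by fun_prop
  have h2 : ContinuousOn (fun q : ℝ × Space N l => c * Real.exp ((1 - γ) * q.1)) (univ ×ˢ Ω) := by
    fun_prop
  exact (h1.smul ((xProj N l).continuous.comp_continuousOn hG)).add
    (h2.smul ((yProj N l).continuous.comp_continuousOn hG))

theorem continuousOn_dilGrad (hγ : 0 ≤ γ) (hΩ : IsOpen Ω) (hu : ContDiffOn ℝ 1 u Ω) :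
    ContinuousOn (fun q : ℝ × Space N l => dilGrad γ u q.1 q.2) (univ ×ˢ Ω) := by
  simpa [dilGrad] using continuousOn_dil_exp hγ hΩ hu 1

/-- Small dilations keep a compact subset of `Ω` inside `Ω`. -/
theorem exists_exp_smul_mem {K : Set (Space N l)} (hΩ : IsOpen Ω) (hK : IsCompact K) (hs : K ⊆ Ω) :
    ∃ δ : ℝ, 0 < δ ∧ ∀ t ∈ closedBall (0 : ℝ) δ, ∀ z ∈ K, Real.exp t • z ∈ Ω := by
  have hcont : Continuous fun q : ℝ × Space N l => Real.exp q.1 • q.2 := by fun_prop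
  obtain ⟨U, V, hU, -, h0, hKV, hUV⟩ := generalized_tube_lemma (isCompact_singleton (x := (0 : ℝ)))
    hK (hΩ.preimage hcont) (by
      rintro ⟨t, z⟩ ⟨ht, hz⟩
      obtain rfl : t = 0 := ht
      simpa using hs hz)
  obtain ⟨δ, hδ, hball⟩ := Metric.nhds_basis_closedBall.mem_iff.1
    (hU.mem_nhds (singleton_subset_iff.1 h0))
  exact ⟨δ, hδ, fun t ht z hz => hUV (mk_mem_prod (hball ht) (hKV hz))⟩

/-- The energy inequality for the dilation `u(e^t ·)`, localized by `η ≥ 0`: the equation tested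
with `η (u(e^t ·) - u)`, combined with the gradient inequality for `ξ ↦ ‖ξ‖ ^ p / p`. -/
theorem IsWeakSolution.setIntegral_dilation_nonneg (hγ : 0 ≤ γ) (hp : 1 < p) (hΩ : IsOpen Ω)
    (hf : Continuous (Function.uncurry f)) (hu : IsWeakSolution Ω γ p f u)
    (huC1 : ContDiffOn ℝ 1 u Ω) (hη : ContDiff ℝ 1 η) (hc : HasCompactSupport η)
    (hs : tsupport η ⊆ Ω) (hpos : ∀ z, 0 ≤ η z) {t : ℝ}
    (ht : ∀ z ∈ tsupport η, Real.exp t • z ∈ Ω) :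
    0 ≤ (∫ z in tsupport η, (fderiv ℝ η z (flux γ p u z) - f z (u z) * η z) *
        (u (Real.exp t • z) - u z)) +
      ((∫ z in tsupport η, η z * (‖dilGrad γ u t (Real.exp t • z)‖ ^ p / p)) -
        ∫ z in tsupport η, η z * (‖grad γ u z‖ ^ p / p)) := by
  have hp0 : 0 < p := by linarith
  set K := tsupport η with hK
  have hKc : IsCompact K := hc
  set c := Real.exp t with hcdef
  have hcont : Continuous fun z : Space N l => c • z := continuous_const_smul c
  set U : Set (Space N l) := Ω ∩ (fun z => c • z) ⁻¹' Ω with hU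
  have hUo : IsOpen U := hΩ.inter (hΩ.preimage hcont)
  have hKU : K ⊆ U := fun z hz => ⟨hs hz, ht z hz⟩
  set v : Space N l → ℝ := fun z => u (c • z) - u z with hv
  have hvC1 : ContDiffOn ℝ 1 v U :=
    (huC1.comp (contDiff_const_smul c).contDiffOn fun z hz => hz.2).sub
      (huC1.mono inter_subset_left)
  have hfu : ContinuousOn (fun z => f z (u z)) K :=
    (hf.comp_continuousOn (continuousOn_id.prodMk huC1.continuousOn)).mono hs
  have hA := (continuousOn_flux hγ hp hΩ huC1).mono hs
  have hG := (continuousOn_norm_grad_rpow hγ hp0 hΩ huC1).mono hs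
  have hDη := (hη.continuous_fderiv one_ne_zero).continuousOn (s := K)
  have hηc := hη.continuous.continuousOn (s := K)
  have hvc : ContinuousOn v K := hvC1.continuousOn.mono hKU
  have hDv : ContinuousOn (fderiv ℝ v) K :=
    (hvC1.continuousOn_fderiv_of_isOpen hUo le_rfl).mono hKU
  have hdil : ContinuousOn (fun z => dilGrad γ u t (c • z)) K :=
    (continuousOn_dilGrad hγ hΩ huC1).comp (f := fun z : Space N l => (t, c • z))
      (continuous_const.prodMk hcont).continuousOn fun z hz => ⟨mem_univ _, ht z hz⟩
  have h1 := hu.integral_fderiv_flux_eq hγ hp hΩ hf huC1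
    (contDiff_mul_of_tsupport_subset hUo hη hKU hvC1) hc.mul_right
    (tsupport_mul_subset_left'.trans hs)
  have hη0 : ∀ z ∉ K, η z = 0 := fun z hz => image_eq_zero_of_notMem_tsupport hz
  rw [← setIntegral_eq_integral_of_forall_compl_eq_zero (s := K) (fun z hz => by
      rw [fderiv_eq_zero_of_notMem_tsupport fun h => hz (tsupport_mul_subset_left' h)]; rfl),
    ← setIntegral_eq_integral_of_forall_compl_eq_zero (s := K) (f := fun z => f z (u z) * _)
      (fun z hz => by rw [hη0 z hz, zero_mul, mul_zero])] at h1
  have h2 : ∫ z in K, fderiv ℝ (fun z => η z * v z) z (flux γ p u z) =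
      ∫ z in K, (η z * fderiv ℝ v z (flux γ p u z) + v z * fderiv ℝ η z (flux γ p u z)) :=
    setIntegral_congr_fun hKc.measurableSet fun z hz =>
      fderiv_mul_apply_of_mem hUo hη hvC1 (hKU hz) _
  have i1 : IntegrableOn (fun z => η z * fderiv ℝ v z (flux γ p u z)) K :=
    (hηc.mul (hDv.clm_apply hA)).integrableOn_compact hKc
  have i2 : IntegrableOn (fun z => v z * fderiv ℝ η z (flux γ p u z)) K :=
    (hvc.mul (hDη.clm_apply hA)).integrableOn_compact hKc
  have i3 : IntegrableOn (fun z => f z (u z) * (η z * v z)) K :=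
    (hfu.mul (hηc.mul hvc)).integrableOn_compact hKc
  have i4 : IntegrableOn (fun z => η z * (‖dilGrad γ u t (c • z)‖ ^ p / p)) K :=
    (hηc.mul ((hdil.norm.rpow_const fun _ _ => Or.inr hp0.le).div_const p)).integrableOn_compact hKc
  have i5 : IntegrableOn (fun z => η z * (‖grad γ u z‖ ^ p / p)) K :=
    (hηc.mul (hG.div_const p)).integrableOn_compact hKc
  rw [h2, integral_add i1 i2] at h1
  have h3 : ∫ z in K, (fderiv ℝ η z (flux γ p u z) - f z (u z) * η z) * v z =
      -∫ z in K, η z * fderiv ℝ v z (flux γ p u z) := by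
    have : ∫ z in K, (fderiv ℝ η z (flux γ p u z) - f z (u z) * η z) * v z =
        (∫ z in K, v z * fderiv ℝ η z (flux γ p u z)) - ∫ z in K, f z (u z) * (η z * v z) := by
      rw [← integral_sub i2 i3]
      refine integral_congr_ae (ae_of_all _ fun z => ?_)
      simp only
      ring
    rw [this]
    linarith
  rw [h3, ← integral_sub i4 i5, neg_add_eq_sub, sub_nonneg]
  refine setIntegral_mono_on i1 (i4.sub i5) hKc.measurableSet fun z hz => ?_
  rw [← mul_sub]
  refine mul_le_mul_of_nonneg_left ?_ (hpos z)
  have hd1 : HasFDerivAt (fun z => u (c • z))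
      ((fderiv ℝ u (c • z)).comp (c • ContinuousLinearMap.id ℝ (Space N l))) z :=
    (((huC1.contDiffAt (hΩ.mem_nhds (ht z hz))).differentiableAt one_ne_zero).hasFDerivAt).comp z
      ((hasFDerivAt_id z).const_smul c)
  have hd2 := ((huC1.contDiffAt (hΩ.mem_nhds (hs hz))).differentiableAt one_ne_zero).hasFDerivAt
  have hd3 : fderiv ℝ v z (flux γ p u z) =
      ⟪flux γ p u z, c • gradient u (c • z) - gradient u z⟫ := by
    have hd4 : HasFDerivAt v ((fderiv ℝ u (c • z)).comp
        (c • ContinuousLinearMap.id ℝ (Space N l)) - fderiv ℝ u z) z := hd1.sub hd2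
    rw [hd4.fderiv, real_inner_comm, inner_sub_left, inner_smul_left, inner_gradient,
      inner_gradient]
    simp
  rw [hd3, inner_flux_left, scale_eq_dil, dil_sub, ← scale_eq_dil, ← scale_eq_dil,
    scale_exp_smul_gradient]
  exact norm_rpow_mul_inner_sub_le hp _ _

/-! ### First variation of the energy under dilations -/

theorem continuousOn_deriv_norm_dilGrad_rpow (hγ : 0 ≤ γ) (hp : 1 < p) (hΩ : IsOpen Ω)
    (hu : ContDiffOn ℝ 1 u Ω) :
    ContinuousOn (fun q : ℝ × Space N l => ‖dilGrad γ u q.1 q.2‖ ^ (p - 2) *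
      ⟪dilGrad γ u q.1 q.2, dil (Real.exp q.1) ((1 - γ) * Real.exp ((1 - γ) * q.1))
        (grad γ u q.2)⟫) (univ ×ˢ Ω) := by
  have h := ((continuous_norm_rpow_smul (E := Space N l) hp).comp_continuousOn
    (continuousOn_dilGrad hγ hΩ hu)).inner (𝕜 := ℝ) (continuousOn_dil_exp hγ hΩ hu (1 - γ))
  simpa only [Function.comp_def, real_inner_smul_left] using h

theorem norm_yPart_grad_sq (γ : ℝ) (u : Space N l → ℝ) (z : Space N l) :
    ‖yPart (grad γ u z)‖ ^ 2 = ‖xPart z‖ ^ (2 * γ) * ‖yPart (gradient u z)‖ ^ 2 := by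
  have h : yPart (grad γ u z) = ‖xPart z‖ ^ γ • yPart (gradient u z) := by
    ext j
    simp [yPart, grad, scale]
  rw [h, norm_smul, mul_pow, Real.norm_eq_abs, sq_abs, ← Real.rpow_natCast, ← Real.rpow_mul
    (norm_nonneg _), mul_comm γ]
  norm_cast

/-- The value at `t = 0`, `w = z` of the derivative in `hasDerivAt_norm_dilGrad_rpow`. -/
theorem norm_grad_rpow_mul_inner_dil (hp : 0 < p) (z : Space N l) :
    ‖grad γ u z‖ ^ (p - 2) * ⟪grad γ u z, dil 1 (1 - γ) (grad γ u z)⟫ =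
      ‖grad γ u z‖ ^ p - ‖grad γ u z‖ ^ (p - 2) * γ * ‖xPart z‖ ^ (2 * γ) *
        ‖yPart (gradient u z)‖ ^ 2 := by
  have h1 : ⟪grad γ u z, dil 1 (1 - γ) (grad γ u z)⟫ =
      ‖grad γ u z‖ ^ 2 - γ * ‖yPart (grad γ u z)‖ ^ 2 := by
    have h := inner_eq_add (grad γ u z) (grad γ u z)
    rw [real_inner_self_eq_norm_sq, real_inner_self_eq_norm_sq, real_inner_self_eq_norm_sq] at h
    rw [← inner_dil_comm, inner_dil_left, real_inner_self_eq_norm_sq, real_inner_self_eq_norm_sq, h]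
    ring
  rw [h1, mul_sub, rpow_sub_two_mul_sq (norm_nonneg _) hp, norm_yPart_grad_sq]
  ring

/-- The field generated by the dilations `z ↦ e^t z`, namely
`|∇_γ u|^{p-2} ⟨∇u, z⟩ (∇_γ u)_γ - |∇_γ u|^p z / p`. -/
noncomputable def pohozaevField (γ p : ℝ) (u : Space N l → ℝ) (z : Space N l) : Space N l :=
  ⟪gradient u z, z⟫ • flux γ p u z - (‖grad γ u z‖ ^ p / p) • z

/-- The divergence of `pohozaevField γ p u` for a solution `u`. -/
noncomputable def pohozaevDensity (γ p : ℝ) (f : Space N l → ℝ → ℝ) (u : Space N l → ℝ)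
    (z : Space N l) : ℝ :=
  -(f z (u z) * ⟪gradient u z, z⟫) + (1 - ((N + l : ℕ) : ℝ) / p) * ‖grad γ u z‖ ^ p -
    ‖grad γ u z‖ ^ (p - 2) * γ * ‖xPart z‖ ^ (2 * γ) * ‖yPart (gradient u z)‖ ^ 2

theorem continuousOn_pohozaevField (hγ : 0 ≤ γ) (hp : 1 < p) (hΩ : IsOpen Ω)
    (hu : ContDiffOn ℝ 1 u Ω) : ContinuousOn (pohozaevField γ p u) Ω :=
  (((continuousOn_gradient hΩ hu).inner (𝕜 := ℝ) continuousOn_id).smul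
    (continuousOn_flux hγ hp hΩ hu)).sub
    (((continuousOn_norm_grad_rpow hγ (by linarith) hΩ hu).div_const p).smul continuousOn_id)

theorem continuousOn_norm_grad_rpow_mul_norm_yPart_sq (hγ : 0 ≤ γ) (hp : 1 < p) (hΩ : IsOpen Ω)
    (hu : ContDiffOn ℝ 1 u Ω) :
    ContinuousOn (fun z => ‖grad γ u z‖ ^ (p - 2) * γ * ‖xPart z‖ ^ (2 * γ) *
      ‖yPart (gradient u z)‖ ^ 2) Ω := by
  have hp0 : 0 < p := by linarith
  have h := (continuousOn_norm_grad_rpow hγ hp0 hΩ hu).sub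
    ((continuousOn_deriv_norm_dilGrad_rpow hγ hp hΩ hu).comp (f := fun z => ((0 : ℝ), z))
      (by fun_prop) fun z hz => ⟨mem_univ _, hz⟩)
  refine h.congr fun z _ => ?_
  simp [dilGrad_zero, norm_grad_rpow_mul_inner_dil hp0]

theorem continuousOn_pohozaevDensity (hγ : 0 ≤ γ) (hp : 1 < p) (hΩ : IsOpen Ω)
    (hf : Continuous (Function.uncurry f)) (hu : ContDiffOn ℝ 1 u Ω) :
    ContinuousOn (pohozaevDensity γ p f u) Ω :=
  (((hf.comp_continuousOn (continuousOn_id.prodMk hu.continuousOn)).mul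
    ((continuousOn_gradient hΩ hu).inner (𝕜 := ℝ) continuousOn_id)).neg.add
    (continuousOn_const.mul (continuousOn_norm_grad_rpow hγ (by linarith) hΩ hu))).sub
    (continuousOn_norm_grad_rpow_mul_norm_yPart_sq hγ hp hΩ hu)

/-- The change of variables `w = c z`, which moves the dilation from the factor `g` to `η`. -/
theorem setIntegral_mul_comp_smul {K K' : Set (Space N l)} {c : ℝ} (hc : 0 < c)
    (hK : ∀ z ∉ K, η z = 0) (hK' : ∀ z ∈ K, c • z ∈ K') (g : Space N l → ℝ) :
    ∫ z in K, η z * g (c • z) = ∫ w in K', (c ^ (N + l))⁻¹ * (η (c⁻¹ • w) * g w) := by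
  have hn : finrank ℝ (Space N l) = N + l := by simp
  rw [setIntegral_eq_integral_of_forall_compl_eq_zero (fun z hz => by rw [hK z hz, zero_mul]),
    setIntegral_eq_integral_of_forall_compl_eq_zero (s := K') (fun w hw => ?_),
    integral_const_mul]
  · have h := Measure.integral_comp_smul_of_nonneg (volume : Measure (Space N l))
      (fun w => η (c⁻¹ • w) * g w) c (hR := hc.le)
    simpa [inv_smul_smul₀ hc.ne', hn] using h
  · rw [hK, zero_mul, mul_zero]
    intro h
    have := hK' _ h
    rw [smul_inv_smul₀ hc.ne'] at this
    exact hw this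

/-- The first variation of the energy inequality `setIntegral_dilation_nonneg` along dilations:
its left side vanishes at `t = 0`, so its derivative there is zero. -/
theorem IsWeakSolution.weak_divergence_pohozaevField (hγ : 0 ≤ γ) (hp : 1 < p) (hΩ : IsOpen Ω)
    (hf : Continuous (Function.uncurry f)) (hu : IsWeakSolution Ω γ p f u)
    (huC1 : ContDiffOn ℝ 1 u Ω) (hη : ContDiff ℝ 1 η) (hc : HasCompactSupport η)
    (hs : tsupport η ⊆ Ω) (hpos : ∀ z, 0 ≤ η z) :
    ∫ z, fderiv ℝ η z (pohozaevField γ p u z) = -∫ z, pohozaevDensity γ p f u z * η z := by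
  have hp0 : 0 < p := by linarith
  set K := tsupport η with hK
  have hKc : IsCompact K := hc
  have hη0 : ∀ z ∉ K, η z = 0 := fun z hz => image_eq_zero_of_notMem_tsupport hz
  obtain ⟨δ, hδ, hδΩ⟩ := exists_exp_smul_mem hΩ hKc hs
  set B := closedBall (0 : ℝ) δ with hB
  have h0B : (0 : ℝ) ∈ B := mem_closedBall_self hδ.le
  have hcont : Continuous fun q : ℝ × Space N l => Real.exp q.1 • q.2 := by fun_prop
  -- A fixed compact domain of integration for all `t`, which contains every `e^t K`.
  set K' := (fun q : ℝ × Space N l => Real.exp q.1 • q.2) '' (B ×ˢ K) with hK'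
  have hK'c : IsCompact K' := ((isCompact_closedBall _ _).prod hKc).image hcont
  have hmem : ∀ t ∈ B, ∀ z ∈ K, Real.exp t • z ∈ K' := fun t ht z hz => ⟨(t, z), ⟨ht, hz⟩, rfl⟩
  have hKK' : K ⊆ K' := fun z hz => by simpa using hmem 0 h0B z hz
  have hK'Ω : K' ⊆ Ω := by
    rintro _ ⟨q, hq, rfl⟩
    exact hδΩ q.1 hq.1 q.2 hq.2
  have hfu : ContinuousOn (fun z => f z (u z)) K :=
    (hf.comp_continuousOn (continuousOn_id.prodMk huC1.continuousOn)).mono hs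
  have hA := (continuousOn_flux hγ hp hΩ huC1).mono hs
  have hDη := hη.continuous_fderiv one_ne_zero
  have ha : ContinuousOn (fun z => fderiv ℝ η z (flux γ p u z) - f z (u z) * η z) K :=
    (hDη.continuousOn.clm_apply hA).sub (hfu.mul hη.continuous.continuousOn)
  have hDu : ContinuousOn (fderiv ℝ u) Ω := huC1.continuousOn_fderiv_of_isOpen hΩ le_rfl
  have hexpΩ : MapsTo (fun q : ℝ × Space N l => Real.exp q.1 • q.2) (B ×ˢ K) Ω :=
    fun q hq => hδΩ q.1 hq.1 q.2 hq.2
  -- The terms coming from the equation.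
  have hd1 := hasDerivAt_setIntegral_of_continuousOn (μ := volume) hKc hδ
    (F := fun t z => (fderiv ℝ η z (flux γ p u z) - f z (u z) * η z) *
      (u (Real.exp t • z) - u z))
    (F' := fun t z => (fderiv ℝ η z (flux γ p u z) - f z (u z) * η z) *
      fderiv ℝ u (Real.exp t • z) (Real.exp t • z))
    ((ha.comp continuousOn_snd fun q hq => hq.2).mul
      ((huC1.continuousOn.comp hcont.continuousOn hexpΩ).sub
        (huC1.continuousOn.comp continuousOn_snd fun q hq => hs hq.2)))
    ((ha.comp continuousOn_snd fun q hq => hq.2).mul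
      ((hDu.comp hcont.continuousOn hexpΩ).clm_apply hcont.continuousOn))
    (fun t ht z hz => by
      have h1 := ((huC1.contDiffAt (hΩ.mem_nhds (hδΩ t ht z hz))).differentiableAt
        one_ne_zero).hasFDerivAt
      have h2 : HasDerivAt (fun s => Real.exp s • z) (Real.exp t • z) t :=
        (Real.hasDerivAt_exp t).smul_const z
      exact ((h1.comp_hasDerivAt t h2).sub_const _).const_mul _)
  -- The energy, after the change of variables `w = e^t z`: the function `u` is now evaluated at a
  -- point independent of `t`, so that no second derivatives of `u` appear.
  have hden := ((continuousOn_dilGrad hγ hΩ huC1).norm.rpow_const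
    (p := p) fun _ _ => Or.inr hp0.le).div_const p
  have hden' := continuousOn_deriv_norm_dilGrad_rpow hγ hp hΩ huC1
  have hsub : B ×ˢ K' ⊆ univ ×ˢ Ω := prod_mono (subset_univ _) hK'Ω
  have hexp : Continuous fun q : ℝ × Space N l => (Real.exp q.1 ^ (N + l))⁻¹ :=
    ((Real.continuous_exp.comp continuous_fst).pow _).inv₀ fun q =>
      pow_ne_zero _ (Real.exp_pos _).ne'
  have hinv : Continuous fun q : ℝ × Space N l => (Real.exp q.1)⁻¹ • q.2 :=
    ((Real.continuous_exp.comp continuous_fst).inv₀ fun q => (Real.exp_pos _).ne').smul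
      continuous_snd
  have hd2 := hasDerivAt_setIntegral_of_continuousOn (μ := volume) hK'c hδ
    (F := fun t w => (Real.exp t ^ (N + l))⁻¹ *
      (η ((Real.exp t)⁻¹ • w) * (‖dilGrad γ u t w‖ ^ p / p)))
    (F' := fun t w => -((N + l : ℕ) : ℝ) * (Real.exp t ^ (N + l))⁻¹ *
        (η ((Real.exp t)⁻¹ • w) * (‖dilGrad γ u t w‖ ^ p / p)) +
      (Real.exp t ^ (N + l))⁻¹ *
        (fderiv ℝ η ((Real.exp t)⁻¹ • w) (-(Real.exp t)⁻¹ • w) * (‖dilGrad γ u t w‖ ^ p / p) +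
          η ((Real.exp t)⁻¹ • w) * (‖dilGrad γ u t w‖ ^ (p - 2) *
            ⟪dilGrad γ u t w, dil (Real.exp t) ((1 - γ) * Real.exp ((1 - γ) * t))
              (grad γ u w)⟫)))
    (hexp.continuousOn.mul ((hη.continuous.comp hinv).continuousOn.mul (hden.mono hsub)))
    (by
      have h1 := (hη.continuous.comp hinv).continuousOn (s := B ×ˢ K')
      refine ((continuousOn_const.mul hexp.continuousOn).mul (h1.mul (hden.mono hsub))).add
        (hexp.continuousOn.mul ((ContinuousOn.mul ?_ (hden.mono hsub)).add
          (h1.mul (hden'.mono hsub))))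
      refine ((hDη.comp hinv).clm_apply ?_).continuousOn
      simp_rw [neg_smul]
      exact hinv.neg)
    (fun t ht w hw => by
      have hi : HasDerivAt (fun s => (Real.exp s)⁻¹) (-(Real.exp t)⁻¹) t := by
        simp_rw [← Real.exp_neg]
        simpa using (hasDerivAt_id t).neg.exp
      have hj : HasDerivAt (fun s => (Real.exp s ^ (N + l))⁻¹)
          (-((N + l : ℕ) : ℝ) * (Real.exp t ^ (N + l))⁻¹) t := by
        simp_rw [← Real.exp_nat_mul, ← Real.exp_neg]
        have := (((hasDerivAt_id t).const_mul (((N + l : ℕ) : ℝ))).neg).exp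
        refine this.congr_deriv ?_
        simp [mul_comm]
      have hk : HasDerivAt (fun s => η ((Real.exp s)⁻¹ • w))
          (fderiv ℝ η ((Real.exp t)⁻¹ • w) (-(Real.exp t)⁻¹ • w)) t :=
        ((hη.differentiable one_ne_zero) _).hasFDerivAt.comp_hasDerivAt t (hi.smul_const w)
      exact hj.mul (hk.mul (hasDerivAt_norm_dilGrad_rpow hp t w)))
  have hcv : ∀ t ∈ B, ∫ z in K, η z * (‖dilGrad γ u t (Real.exp t • z)‖ ^ p / p) =
      ∫ w in K', (Real.exp t ^ (N + l))⁻¹ *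
        (η ((Real.exp t)⁻¹ • w) * (‖dilGrad γ u t w‖ ^ p / p)) := fun t ht =>
    setIntegral_mul_comp_smul (Real.exp_pos t) hη0 (hmem t ht) fun w => ‖dilGrad γ u t w‖ ^ p / p
  -- The left side of the energy inequality has a minimum at `t = 0`, where it vanishes.
  have hd := hd1.add (hd2.sub_const (∫ z in K, η z * (‖grad γ u z‖ ^ p / p)))
  have hmin := IsLocalMin.hasDerivAt_eq_zero (a := (0 : ℝ)) (by
    filter_upwards [closedBall_mem_nhds (0 : ℝ) hδ] with t ht
    have h1 := hcv 0 h0B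
    simp only [dilGrad_zero, Real.exp_zero, one_smul] at h1
    have h2 := hu.setIntegral_dilation_nonneg hγ hp hΩ hf huC1 hη hc hs hpos
      (t := t) (hδΩ t ht)
    rw [hcv t ht] at h2
    simp only [Pi.add_apply, Real.exp_zero, one_smul, sub_self, mul_zero, integral_zero, zero_add,
      dilGrad_zero, ← h1]
    exact h2) hd
  simp only [dilGrad_zero, Real.exp_zero, one_smul, mul_zero, mul_one, inv_one, one_pow, one_mul,
    neg_smul, map_neg, norm_grad_rpow_mul_inner_dil hp0] at hmin
  have hD0 : ∀ z ∉ K, fderiv ℝ η z = 0 := fun z hz => fderiv_eq_zero_of_notMem_tsupport hz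
  rw [setIntegral_eq_integral_of_forall_compl_eq_zero (s := K') (fun z hz => by
      simp [hη0 z fun h => hz (hKK' h), hD0 z fun h => hz (hKK' h)]),
    ← setIntegral_eq_integral_of_forall_compl_eq_zero (s := K) (μ := volume) (fun z hz => by
      simp [hη0 z hz, hD0 z hz])] at hmin
  rw [← setIntegral_eq_integral_of_forall_compl_eq_zero (s := K) (fun z hz => by
      rw [hD0 z hz]; rfl),
    ← setIntegral_eq_integral_of_forall_compl_eq_zero (s := K) (f := fun z => _ * η z)
      (fun z hz => by rw [hη0 z hz, mul_zero])]
  have i1 : IntegrableOn (fun z => (fderiv ℝ η z (flux γ p u z) - f z (u z) * η z) *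
      fderiv ℝ u z z) K :=
    (ha.mul ((hDu.mono hs).clm_apply continuousOn_id)).integrableOn_compact hKc
  have i2 : IntegrableOn (fun z => fderiv ℝ η z (pohozaevField γ p u z)) K :=
    (hDη.continuousOn.clm_apply ((continuousOn_pohozaevField hγ hp hΩ huC1).mono hs))
      |>.integrableOn_compact hKc
  have i3 : IntegrableOn (fun z => pohozaevDensity γ p f u z * η z) K :=
    (((continuousOn_pohozaevDensity hγ hp hΩ hf huC1).mono hs).mul
      hη.continuous.continuousOn).integrableOn_compact hKc
  have h23 : IntegrableOn (fun z => fderiv ℝ η z (pohozaevField γ p u z) +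
      pohozaevDensity γ p f u z * η z) K := i2.add i3
  rw [eq_neg_iff_add_eq_zero, ← integral_add i2 i3, ← hmin, ← sub_eq_iff_eq_add',
    ← integral_sub h23 i1]
  refine integral_congr_ae (ae_of_all _ fun z => ?_)
  simp only [pohozaevField, pohozaevDensity, map_sub, map_smul, smul_eq_mul,
    inner_gradient]
  field_simp
  ring

theorem locallyIntegrableOn_inner_id (hΩ : IsOpen Ω)
    {H : Space N l → Space N l} (hH : LocallyIntegrableOn H Ω) :
    LocallyIntegrableOn (fun z => ⟪H z, z⟫) Ω := by
  refine (locallyIntegrableOn_iff hΩ.isLocallyClosed).2 fun k hk hkc => ?_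
  have hHk := hH.integrableOn_compact_subset hk hkc
  obtain ⟨C, hC⟩ := hkc.exists_bound_of_continuousOn (f := fun z => z) continuousOn_id
  refine (hHk.norm.mul_const C).mono' (hHk.aestronglyMeasurable.inner aestronglyMeasurable_id) ?_
  filter_upwards [ae_restrict_mem hkc.measurableSet] with z hz
  exact (norm_inner_le_norm _ _).trans (mul_le_mul_of_nonneg_left (hC z hz) (norm_nonneg _))

end Grushin

/-! ### Combination of the three identities -/

theorem theorem1p2 (N l : ℕ) (hNl : 3 ≤ N + l) (γ p : ℝ) (hγ : 0 ≤ γ) (hp : 1 < p)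
    (Ω : Set (Grushin.Space N l)) (hΩ : IsOpen Ω) (hΩb : Bornology.IsBounded Ω)
    (f : Grushin.Space N l → ℝ → ℝ) (hf : Continuous (Function.uncurry f))
    (u : Grushin.Space N l → ℝ) (hu : Grushin.IsWeakSolution Ω γ p f u)
    (huC1 : ContDiffOn ℝ 1 u Ω)
    (dF : Grushin.Space N l → Grushin.Space N l) (hdF : Grushin.IsPartialGradient Ω f u dF)
    (D : Set (Grushin.Space N l)) (hD : IsOpen D) (hDΩ : closure D ⊆ Ω)
    (hDC1 : Grushin.HasC1Boundary D)
    (ν : Grushin.Space N l → Grushin.Space N l)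
    (hν : ∀ z ∈ frontier D, Grushin.IsOutwardUnitNormal D z (ν z)) :
    (-((N + l : ℕ) : ℝ) / p + 1) * (∫ z in D, f z (u z) * u z)
      + (-((N + l : ℕ) : ℝ) / p + 1) *
          (∫ z, ‖Grushin.grad γ u z‖ ^ (p - 2) * u z *
            inner ℝ (Grushin.grad γ u z) (Grushin.scale γ z (ν z)) ∂Grushin.surfaceMeasure D)
      + 1 / p * (∫ z, ‖Grushin.grad γ u z‖ ^ p * inner ℝ z (ν z) ∂Grushin.surfaceMeasure D)
      - (∫ z, ‖Grushin.grad γ u z‖ ^ (p - 2) * inner ℝ (gradient u z) z *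
            inner ℝ (Grushin.grad γ u z) (Grushin.scale γ z (ν z)) ∂Grushin.surfaceMeasure D)
      - (∫ z in D, ‖Grushin.grad γ u z‖ ^ (p - 2) * γ * ‖Grushin.xPart z‖ ^ (2 * γ) *
            ‖Grushin.yPart (gradient u z)‖ ^ 2)
    = (∫ z, Grushin.primitive f z (u z) * inner ℝ z (ν z) ∂Grushin.surfaceMeasure D)
      - ((N + l : ℕ) : ℝ) * (∫ z in D, Grushin.primitive f z (u z))
      - (∫ z in D, inner ℝ (dF z) z) := by
  have hp0 : 0 < p := by linarith
  have hN := Grushin.hasUnitNormal hD hν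
  have hDb : Bornology.IsBounded D := hΩb.subset (subset_closure.trans hDΩ)
  have hDc : IsCompact (closure D) := hDb.isCompact_closure
  have hFc : IsCompact (frontier D) := hDc.of_isClosed_subset isClosed_frontier
    frontier_subset_closure
  have hFΩ : frontier D ⊆ Ω := frontier_subset_closure.trans hDΩ
  -- The subtraction in the dimension of the surface measure does not truncate, as `1 ≤ N + l`.
  have hm : finrank ℝ (Grushin.Space N l) = (N + l - 1) + 1 := by
    rw [finrank_euclideanSpace, Fintype.card_sum, Fintype.card_fin, Fintype.card_fin]
    omega
  have hG := Grushin.continuousOn_norm_grad_rpow hγ hp0 hΩ huC1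
  have hfu : ContinuousOn (fun z => f z (u z)) Ω :=
    hf.comp_continuousOn (continuousOn_id.prodMk huC1.continuousOn)
  have hflux := Grushin.continuousOn_flux hγ hp hΩ huC1
  have hdu := Grushin.continuousOn_gradient hΩ huC1
  have hQ := Grushin.continuousOn_norm_grad_rpow_mul_norm_yPart_sq hγ hp hΩ huC1
  have hΦ : ContinuousOn (fun z => Grushin.primitive f z (u z)) Ω := fun z hz =>
    (hdF.hasGradientAt z hz).continuousAt.continuousWithinAt
  have hzdu : ContinuousOn (fun z => ⟪gradient u z, z⟫) Ω := hdu.inner (𝕜 := ℝ) continuousOn_id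
  have intD : ∀ {g : Grushin.Space N l → ℝ}, ContinuousOn g Ω → IntegrableOn g D := fun hg =>
    ((hg.mono hDΩ).integrableOn_compact hDc).mono_set subset_closure
  have intS : ∀ {g : Grushin.Space N l → ℝ}, ContinuousOn g (frontier D) →
      Integrable g (Grushin.surfaceMeasure D) := fun {g} hg => by
    obtain ⟨C, hC⟩ := hFc.exists_bound_of_continuousOn hg
    have : IsFiniteMeasure (Grushin.surfaceMeasure D) := ⟨by
      rw [Grushin.surfaceMeasure, Measure.restrict_apply_univ]
      exact hN.measure_frontier_lt_top hD hDb hm⟩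
    exact Integrable.of_bound (hg.aestronglyMeasurable hFc.measurableSet) C
      ((ae_restrict_mem hFc.measurableSet).mono hC)
  -- The divergence theorem for the fields `V₁`, `V₂` and `V₃`.
  have e1 := hN.setIntegral_eq_of_weak_divergence (V := fun z => u z • Grushin.flux γ p u z)
    (w := fun z => ‖Grushin.grad γ u z‖ ^ p - f z (u z) * u z) hD hDb hm hΩ hDΩ
    (huC1.continuousOn.smul hflux)
    ((hG.sub (hfu.mul huC1.continuousOn)).locallyIntegrableOn hΩ.measurableSet)
    fun η hη hc hs _ => hu.weak_divergence_smul_flux hγ hp hΩ hf huC1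
      (hη.of_le (by norm_num)) hc hs
  have e2 := hN.setIntegral_eq_of_weak_divergence hD hDb hm hΩ hDΩ
    (Grushin.continuousOn_pohozaevField hγ hp hΩ huC1)
    ((Grushin.continuousOn_pohozaevDensity hγ hp hΩ hf huC1).locallyIntegrableOn hΩ.measurableSet)
    fun η hη hc hs hpos => hu.weak_divergence_pohozaevField hγ hp hΩ hf huC1
      (hη.of_le (by norm_num)) hc hs hpos
  have hH : LocallyIntegrableOn (fun z => dF z + f z (u z) • gradient u z) Ω :=
    hdF.locallyIntegrableOn.add ((hfu.smul hdu).locallyIntegrableOn hΩ.measurableSet)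
  have hdFz : LocallyIntegrableOn (fun z => ⟪dF z, z⟫) Ω :=
    Grushin.locallyIntegrableOn_inner_id hΩ hdF.locallyIntegrableOn
  have hHz : LocallyIntegrableOn (fun z => ((N + l : ℕ) : ℝ) * Grushin.primitive f z (u z) +
      ⟪dF z + f z (u z) • gradient u z, z⟫) Ω := by
    simp only [inner_add_left, real_inner_smul_left]
    exact ((continuousOn_const.mul hΦ).locallyIntegrableOn hΩ.measurableSet).add
      (hdFz.add ((hfu.mul hzdu).locallyIntegrableOn hΩ.measurableSet))
  have e3 := hN.setIntegral_eq_of_weak_divergence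
    (V := fun z => Grushin.primitive f z (u z) • z) hD hDb hm hΩ hDΩ
    (hΦ.smul continuousOn_id) hHz
    fun η hη hc hs _ => Grushin.weak_divergence_smul_id hdF.hasGradientAt hH
      (hη.of_le (by norm_num)) hc hs
  have hdFi : IntegrableOn (fun z => ⟪dF z, z⟫) D :=
    (hdFz.integrableOn_compact_subset hDΩ hDc).mono_set subset_closure
  have hNc := hN.continuousOn
  have b1 : Integrable (fun z => ⟪gradient u z, z⟫ * (‖Grushin.grad γ u z‖ ^ (p - 2) *
      ⟪Grushin.grad γ u z, Grushin.scale γ z (ν z)⟫)) (Grushin.surfaceMeasure D) := by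
    simp only [← Grushin.inner_flux_left]
    exact intS ((hzdu.mono hFΩ).mul ((hflux.mono hFΩ).inner (𝕜 := ℝ) hNc))
  have b2 : Integrable (fun z => ‖Grushin.grad γ u z‖ ^ p / p * ⟪z, ν z⟫)
      (Grushin.surfaceMeasure D) :=
    intS (((hG.div_const p).mono hFΩ).mul (continuousOn_id.inner (𝕜 := ℝ) hNc))
  have d1 : IntegrableOn (fun z => f z (u z) * u z) D := intD (hfu.mul huC1.continuousOn)
  have d2 : IntegrableOn (fun z => f z (u z) * ⟪gradient u z, z⟫) D := intD (hfu.mul hzdu)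
  have d6 : IntegrableOn (fun z => -(f z (u z) * ⟪gradient u z, z⟫)) D := d2.neg
  have d3 := (intD hG).const_mul (1 - ((N + l : ℕ) : ℝ) / p)
  have d4 : IntegrableOn (fun z => -(f z (u z) * ⟪gradient u z, z⟫) +
      (1 - ((N + l : ℕ) : ℝ) / p) * ‖Grushin.grad γ u z‖ ^ p) D := d6.add d3
  have d5 : IntegrableOn (fun z => ⟪dF z, z⟫ + f z (u z) * ⟪gradient u z, z⟫) D := hdFi.add d2
  change _ = ∫ z, _ ∂Grushin.surfaceMeasure D at e1 e2 e3
  simp only [real_inner_smul_left, Grushin.inner_flux_left, Grushin.pohozaevField,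
    inner_sub_left, Grushin.pohozaevDensity, inner_add_left] at e1 e2 e3
  rw [integral_sub (intD hG) d1] at e1
  rw [integral_sub b1 b2, integral_sub d4 (intD hQ), integral_add d6 d3, integral_neg,
    integral_const_mul] at e2
  rw [integral_add ((intD hΦ).const_mul _) d5, integral_add hdFi d2, integral_const_mul] at e3
  have s1 : ∀ z, ‖Grushin.grad γ u z‖ ^ (p - 2) * u z *
      ⟪Grushin.grad γ u z, Grushin.scale γ z (ν z)⟫ = u z * (‖Grushin.grad γ u z‖ ^ (p - 2) *
      ⟪Grushin.grad γ u z, Grushin.scale γ z (ν z)⟫) := fun z => by ring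
  have s2 : ∀ z, ‖Grushin.grad γ u z‖ ^ (p - 2) * ⟪gradient u z, z⟫ *
      ⟪Grushin.grad γ u z, Grushin.scale γ z (ν z)⟫ = ⟪gradient u z, z⟫ *
      (‖Grushin.grad γ u z‖ ^ (p - 2) * ⟪Grushin.grad γ u z, Grushin.scale γ z (ν z)⟫) :=
    fun z => by ring
  have s3 : ∫ z, ‖Grushin.grad γ u z‖ ^ p / p * ⟪z, ν z⟫ ∂Grushin.surfaceMeasure D =
      1 / p * ∫ z, ‖Grushin.grad γ u z‖ ^ p * ⟪z, ν z⟫ ∂Grushin.surfaceMeasure D := by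
    rw [← integral_const_mul]
    exact integral_congr_ae (ae_of_all _ fun z => by ring)
  rw [s3] at e2
  simp only [s1, s2]
  rw [← e1]
  -- `e1` eliminates the boundary term with `u`; `e2` and `e3` cancel `∫_D f(z, u) ⟪∇u, z⟫`.
  linear_combination e2 + e3
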